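/- For $n\ge 1$ let $B_n=\langle \sigma_1,\dots,\sigma_{n-1}\mid \sigma_i\sigma_j=\sigma_j\sigma_i\ (|i-j|\ge 2),\ \sigma_i\sigma_j\sigma_i=\sigma_j\sigma_i\sigma_j\ (|i-j|=1)\rangle$ be Artin's braid group, with $B_{n-1}\subset B_n$ via $\sigma_i\mapsto\sigma_i$. For $1\le p<q\le n$ put $a_{p,q}=\sigma_p\cdots\sigma_{q-2}\,\sigma_{q-1}\,\sigma_{q-2}^{-1}\cdots\sigma_p^{-1}$, let $\mathrm{BKL}_n$ (the dual braid monoid) be the submonoid of $B_n$ generated by these elements, let $\Delta_n=a_{1,2}a_{2,3}\cdots a_{n-1,n}=\sigma_1\cdots\sigma_{n-1}$, and let $\varphi_n(\beta)=\Delta_n\beta\Delta_n^{-1}$. For $n\ge3$, the $\mathrm{BKL}_{n-1}$-tail of $\beta\in\mathrm{BKL}_n$ is the maximal right-divisor of $\beta$ (for right-divisibility in $\mathrm{BKL}_n$) that lies in $\mathrm{BKL}_{n-1}$. The $\varphi_n$-splitting of a nontrivial $\beta\in\mathrm{BKL}_n$ is the unique sequence $(\beta_r,\dots,\beta_1)$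 in $\mathrm{BKL}_{n-1}$ such that $\beta_r\ne1$, $\beta=\varphi_n^{r-1}(\beta_r)\cdots\varphi_n(\beta_2)\,\beta_1$ and, for each $k\ge1$, the $\mathrm{BKL}_{n-1}$-tail of $\varphi_n^{r-k}(\beta_r)\cdots\varphi_n(\beta_{k+1})$ is trivial; the splitting of $1$ is the length one sequence $(1)$. The length $r$ is the $n$-breadth of $\beta$. The ordering $<^*$ on $\mathrm{BKL}_n$ ($n\ge2$) is defined recursively: on $\mathrm{BKL}_2$, $a_{1,2}^i<^*a_{1,2}^j$ if and only if $i<j$; for $n\ge3$ and $\beta,\gamma\in\mathrm{BKL}_n$, $\beta<^*\gamma$ if and only if the $\varphi_n$-splitting of $\beta$ is smaller than that of $\gamma$ for the ShortLex-extension of the ordering $<^*$ of $\mathrm{BKL}_{n-1}$ (compare lengths first and then, for equal lengths, lexicographically from the left). For $n\ge3$ and $p\ge1$ let $\delta_{n,p}=\varphi_n^{p+1}(a_{n-2,n-1})\cdot\varphi_n^{p}(a_{n-2,n-1})\cdots\varphi_n^2(a_{n-2,n-1})$. **Proposition.** For all $n\ge3$ and $p\ge1$: (i) the $\varphi_n$-splitting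 of $\delta_{n,p}$ is the sequence $(a_{n-2,n-1},\dots,a_{n-2,n-1},1,1)$ of length $p+2$; (ii) $\delta_{n,p}=\Delta_n^{p}\,\Delta_{n-1}^{-p}$; (iii) $\delta_{n,p}$ is the $<^*$-smallest braid in $\mathrm{BKL}_n$ that has $n$-breadth $p+2$; moreover, it is the least upper bound, in $(\mathrm{BKL}_n,<^*)$, of the set of all braids of $\mathrm{BKL}_n$ of $n$-breadth at most $p+1$. -/

import Mathlib

namespace DualBraid

/-- The indices `1, …, n - 1` of the Artin generators of the `n`-strand braid group. -/
abbrev Idx (n : ℕ) : Type := {i : ℕ // 1 ≤ i ∧ i < n}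

/-- Artin's relators: `σᵢ σⱼ = σⱼ σᵢ` for `|i - j| ≥ 2` and `σᵢ σⱼ σᵢ = σⱼ σᵢ σⱼ` for
`|i - j| = 1`. -/
def artinRels (n : ℕ) : Set (FreeGroup (Idx n)) :=
  {r | ∃ i j : Idx n, (i.1 + 2 ≤ j.1 ∨ j.1 + 2 ≤ i.1) ∧
      r = (FreeGroup.of i * FreeGroup.of j) * (FreeGroup.of j * FreeGroup.of i)⁻¹} ∪
  {r | ∃ i j : Idx n, (i.1 + 1 = j.1 ∨ j.1 + 1 = i.1) ∧
      r = (FreeGroup.of i * FreeGroup.of j * FreeGroup.of i) *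
        (FreeGroup.of j * FreeGroup.of i * FreeGroup.of j)⁻¹}

/-- Artin's braid group `Bₙ` on `n` strands. -/
abbrev B (n : ℕ) : Type := PresentedGroup (artinRels n)

/-- The generator `σᵢ` of `Bₙ`, for `1 ≤ i < n` (and `1` for an index out of this range). -/
def σ (n i : ℕ) : B n :=
  if h : 1 ≤ i ∧ i < n then PresentedGroup.of ⟨i, h⟩ else 1

/-- The index `i` seen as an index for one more strand. -/
def Idx.up {n : ℕ} (i : Idx (n - 1)) : Idx n :=
  ⟨i.1, i.2.1, lt_of_lt_of_le i.2.2 (Nat.sub_le n 1)⟩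

theorem incl_rels (n : ℕ) : ∀ r ∈ artinRels (n - 1),
    FreeGroup.lift (fun i : Idx (n - 1) => (PresentedGroup.of i.up : B n)) r = 1 := by
  rintro r (⟨i, j, hij, rfl⟩ | ⟨i, j, hij, rfl⟩)
  · have h : (PresentedGroup.mk (artinRels n))
        ((FreeGroup.of i.up * FreeGroup.of j.up) * (FreeGroup.of j.up * FreeGroup.of i.up)⁻¹)
        = 1 := PresentedGroup.one_of_mem (Or.inl ⟨i.up, j.up, hij, rfl⟩)
    simpa [PresentedGroup.of] using h
  · have h : (PresentedGroup.mk (artinRels n))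
        ((FreeGroup.of i.up * FreeGroup.of j.up * FreeGroup.of i.up) *
          (FreeGroup.of j.up * FreeGroup.of i.up * FreeGroup.of j.up)⁻¹)
        = 1 := PresentedGroup.one_of_mem (Or.inr ⟨i.up, j.up, hij, rfl⟩)
    simpa [PresentedGroup.of] using h

/-- The canonical embedding `Bₙ₋₁ → Bₙ`, `σᵢ ↦ σᵢ` (adding an unbraided last strand). -/
def incl (n : ℕ) : B (n - 1) →* B n :=
  PresentedGroup.toGroup (incl_rels n)

/-- `σₚ σₚ₊₁ ⋯ σ_{q-1}` in `Bₙ`; it is `1` for `q ≤ p`. -/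
def sigmaProd (n p q : ℕ) : B n := ((List.Ico p q).map (σ n)).prod

/-- The Birman–Ko–Lee generator
`a_{p,q} = σₚ ⋯ σ_{q-2} · σ_{q-1} · σ_{q-2}⁻¹ ⋯ σₚ⁻¹` of `Bₙ`, for `1 ≤ p < q ≤ n`. -/
def a (n p q : ℕ) : B n :=
  sigmaProd n p (q - 1) * σ n (q - 1) * (sigmaProd n p (q - 1))⁻¹

/-- The dual braid monoid `BKLₙ`, a submonoid of `Bₙ`. -/
def BKL (n : ℕ) : Submonoid (B n) :=
  Submonoid.closure {x | ∃ p q : ℕ, 1 ≤ p ∧ p < q ∧ q ≤ n ∧ x = a n p q}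

/-- The Garside element `Δₙ = a_{1,2} a_{2,3} ⋯ a_{n-1,n}` of `BKLₙ`. -/
def Δ (n : ℕ) : B n := ((List.Ico 1 n).map fun i => a n i (i + 1)).prod

/-- The Garside automorphism `φₙ : β ↦ Δₙ β Δₙ⁻¹`. -/
def φ (n : ℕ) : MulAut (B n) := MulAut.conj (Δ n)

/-- `x` right-divides `y` in `BKLₙ`. -/
def RightDvd (n : ℕ) (x y : B n) : Prop := ∃ z ∈ BKL n, y = z * x

/-- `t` is the `BKLₙ₋₁`-tail of `x`: the maximal right-divisor of `x` that lies in `BKLₙ₋₁`. -/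
def IsTail (n : ℕ) (x : B n) (t : B (n - 1)) : Prop :=
  t ∈ BKL (n - 1) ∧ RightDvd n (incl n t) x ∧
    ∀ u ∈ BKL (n - 1), RightDvd n (incl n u) x → RightDvd n (incl n u) (incl n t)

/-- For a sequence `(β_r, …, β₁)` in `Bₙ₋₁`, the product
`φₙ^{r-1}(β_r) ⋯ φₙ(β₂) · β₁` in `Bₙ`. -/
def splitProd (n : ℕ) : List (B (n - 1)) → B n
  | [] => 1
  | b :: s => (φ n ^ s.length) (incl n b) * splitProd n s

/-- The sequence `s = (β_r, …, β₁)` is the `φₙ`-splitting of the braid `β` of `BKLₙ`.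
The entries lie in `BKLₙ₋₁`, the product `φₙ^{r-1}(β_r) ⋯ φₙ(β₂) · β₁` is `β`, for each `k ≥ 1` the
`BKLₙ₋₁`-tail of `φₙ^{r-k}(β_r) ⋯ φₙ(β_{k+1})` is trivial, and `β_r ≠ 1`.
The sequence is nonempty and the last condition is not imposed when `r = 1`, so that the
splitting of each `β` in `BKLₙ₋₁`, including `β = 1`, is the length one sequence `(β)`. -/
def IsSplitting (n : ℕ) (β : B n) (s : List (B (n - 1))) : Prop :=
  β ∈ BKL n ∧ s ≠ [] ∧ (∀ b ∈ s, b ∈ BKL (n - 1)) ∧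
  (2 ≤ s.length → s.head? ≠ some 1) ∧
  β = splitProd n s ∧
  ∀ k : ℕ, 1 ≤ k → k ≤ s.length → IsTail n (φ n (splitProd n (s.take (s.length - k)))) 1

/-- `β` is a braid of `BKLₙ` with `n`-breadth `r`, i.e. its `φₙ`-splitting has length `r`. -/
def HasBreadth (n : ℕ) (β : B n) (r : ℕ) : Prop :=
  ∃ s, IsSplitting n β s ∧ s.length = r

/-- The rotating ordering `<*` on `BKLₙ`, for `n ≥ 2`. On `BKL₂` it is the ordering of the exponents
of `a_{1,2}`; on `BKLₙ`, `n ≥ 3`, it compares `φₙ`-splittings by the ShortLex-extension of the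
ordering of `BKLₙ₋₁` (length first, then lexicographically from the left). -/
def RotLT : (n : ℕ) → B n → B n → Prop
  | 0, _, _ => False
  | 1, _, _ => False
  | 2, β, γ => ∃ i j : ℕ, i < j ∧ β = a 2 1 2 ^ i ∧ γ = a 2 1 2 ^ j
  | m + 3, β, γ => ∃ s t : List (B (m + 2)),
      IsSplitting (m + 3) β s ∧ IsSplitting (m + 3) γ t ∧ List.Shortlex (RotLT (m + 2)) s t

/-- `β ≤* γ`. -/
def RotLE (n : ℕ) (β γ : B n) : Prop := RotLT n β γ ∨ β = γ

/-- The separator `δ_{n,p} = φₙ^{p+1}(a_{n-2,n-1}) ⋯ φₙ²(a_{n-2,n-1})`, for `n ≥ 3`, `p ≥ 1`. -/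
def sep (n p : ℕ) : B n :=
  ((List.range p).reverse.map fun j => (φ n ^ (j + 2)) (a n (n - 2) (n - 1))).prod

end DualBraid

namespace DualBraid

open Equiv

/-- `j` lies strictly between `i` and `x` when the naturals are read cyclically from `i` on. -/
def Gap (i x j : ℕ) : Prop := (i < x ∧ i < j ∧ j < x) ∨ (x ≤ i ∧ (i < j ∨ j < x))

/-- `i` and `j` lie on the same side of all arcs `k → t k`. -/
def Rel (t : Perm ℕ) (i j : ℕ) : Prop := ∀ k, Gap k (t k) i ↔ Gap k (t k) j

/-- `s` leaves invariant all gaps of `t`. -/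
def Below (s t : Perm ℕ) : Prop := ∀ j, Rel t j (s j)

theorem Rel.refl (t : Perm ℕ) (i : ℕ) : Rel t i i := fun _ => Iff.rfl

theorem Rel.symm {t : Perm ℕ} {i j : ℕ} (h : Rel t i j) : Rel t j i := fun k => (h k).symm

theorem Rel.trans {t : Perm ℕ} {i j l : ℕ} (h : Rel t i j) (h' : Rel t j l) : Rel t i l :=
  fun k => (h k).trans (h' k)

theorem Below.rel {t u : Perm ℕ} (ht : Below t t) (h : Below t u) {i j : ℕ} (hij : Rel t i j) :
    Rel u i j := by
  suffices H : ∀ d i j, i < j → j - i ≤ d → Rel t i j → Rel u i j by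
    rcases lt_trichotomy i j with h1 | h1 | h1
    · exact H _ i j h1 le_rfl hij
    · exact h1 ▸ Rel.refl u i
    · exact (H _ j i h1 le_rfl hij.symm).symm
  intro d
  induction d with
  | zero => intro i j h1 h2; omega
  | succ d ih =>
    intro i j h1 h2 h3
    have h4 := h3 i
    have h5 : i < t i ∧ t i ≤ j := by unfold Gap at h4; omega
    rcases eq_or_lt_of_le h5.2 with h6 | h6
    · exact h6 ▸ h i
    · exact (h i).trans (ih _ _ h6 (by omega) ((ht i).symm.trans h3))

theorem Below.trans {s t u : Perm ℕ} (ht : Below t t) (h : Below s t) (h' : Below t u) :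
    Below s u := fun j => Below.rel ht h' (h j)

theorem Below.antisymm {s t : Perm ℕ} (h : Below s t) (h' : Below t s) : s = t := by
  ext i
  have h1 := h i i
  have h2 := h' i i
  unfold Gap at h1 h2; omega

theorem one_below (t : Perm ℕ) : Below 1 t := fun j => Rel.refl t j

theorem Below.inv {s t : Perm ℕ} (h : Below s t) : Below s⁻¹ t := fun j => by
  have := h (s⁻¹ j); rw [Perm.coe_inv, Equiv.apply_symm_apply] at this; exact this.symm

theorem Below.mul {r s t : Perm ℕ} (h : Below r t) (h' : Below s t) : Below (r * s) t := fun j =>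
  (h' j).trans (h (s j))

theorem Below.mul_inv_mul_inv {w v u : Perm ℕ} (hv : Below v v) (hu : Below u u) (hwv : Below w v)
    (hvu : Below v u) : Below (u * v⁻¹) (u * w⁻¹) := by
  intro j i
  obtain ⟨k, rfl⟩ := w.surjective i
  obtain ⟨m, rfl⟩ := v.surjective j
  simp only [Perm.mul_apply, Perm.coe_inv, Equiv.symm_apply_apply]
  have hwu := Below.trans hv hwv hvu
  rcases eq_or_ne m k with rfl | hmk
  · have h1 := hwv m m
    have h2 := hvu m m
    unfold Gap at *
    omega
  have e2 : u m ≠ u k := u.injective.ne hmk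
  have h1 := hwv k m
  have h3 := hvu m k
  have h6 := hu m k
  have h7 := hwu k m
  unfold Gap at *
  grind

theorem Below.inv_mul_inv_mul {w v u : Perm ℕ} (hv : Below v v) (hu : Below u u) (hwv : Below w v)
    (hvu : Below v u) : Below (v⁻¹ * u) (w⁻¹ * u) := by
  intro j i
  have hwu := Below.trans hv hwv hvu
  simp only [Perm.mul_apply]
  obtain ⟨k, hk⟩ := w.surjective (u i)
  obtain ⟨m, hm⟩ := v.surjective (u j)
  rw [← hk, ← hm, Perm.coe_inv, Perm.coe_inv, Equiv.symm_apply_apply, Equiv.symm_apply_apply]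
  have h1 := hwu k i
  have h2 := hvu m j
  have h7 := hwv k m
  rw [hm] at h7 h2
  rw [hk] at h1 h7
  rcases eq_or_ne i j with rfl | hij
  · unfold Gap at *
    omega
  have h3 := hu j i
  have h5 := hwu k j
  have h6 := hvu m i
  have e2 : u i ≠ u j := u.injective.ne hij
  rw [hk] at h5
  rw [hm] at h6
  unfold Gap at *
  grind
end DualBraid

namespace DualBraid

open Equiv

theorem Rel.of_crossing {u : Perm ℕ} {i m j l : ℕ} (h : Rel u i m) (h' : Rel u j l)
    (hj : Gap i m j) (hl : ¬ Gap i m l) : Rel u i j := by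
  intro k
  have h1 := h k
  have h2 := h' k
  unfold Gap at *
  grind

/-- `i` and `j` are equivalent for all members of `U`. -/
def RelAll (U : Set (Perm ℕ)) (i j : ℕ) : Prop := ∀ u ∈ U, Rel u i j

theorem RelAll.exists_next (U : Set (Perm ℕ)) (i : ℕ) :
    ∃ x, RelAll U i x ∧ ∀ j, RelAll U i j → ¬ Gap i x j := by
  classical
  by_cases h : ∃ j, i < j ∧ RelAll U i j
  · refine ⟨Nat.find h, (Nat.find_spec h).2, fun j hj hg => ?_⟩
    have h1 := (Nat.find_spec h).1
    have h2 : i < j ∧ j < Nat.find h := by unfold Gap at hg; omega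
    exact Nat.find_min h h2.2 ⟨h2.1, hj⟩
  · have h0 : ∃ j, RelAll U i j := ⟨i, fun u _ => Rel.refl u i⟩
    refine ⟨Nat.find h0, Nat.find_spec h0, fun j hj hg => ?_⟩
    have h1 : Nat.find h0 ≤ i := Nat.find_min' h0 fun u _ => Rel.refl u i
    have h2 : i < j ∨ j < Nat.find h0 := by unfold Gap at hg; omega
    rcases h2 with h2 | h2
    · exact h ⟨j, h2, hj⟩
    · exact Nat.find_min h0 h2 hj

/-- `t` moves only points of `{1, …, n}`. -/
def Supp (n : ℕ) (t : Perm ℕ) : Prop := ∀ i, ¬ (1 ≤ i ∧ i ≤ n) → t i = i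

theorem Supp.mono {m n : ℕ} (h : m ≤ n) {t : Perm ℕ} (ht : Supp m t) : Supp n t :=
  fun i hi => ht i (by omega)

theorem Supp.mul {n : ℕ} {s t : Perm ℕ} (hs : Supp n s) (ht : Supp n t) : Supp n (s * t) :=
  fun i hi => by rw [Perm.mul_apply, ht i hi, hs i hi]

theorem Supp.inv {n : ℕ} {s : Perm ℕ} (hs : Supp n s) : Supp n s⁻¹ :=
  fun i hi => by rw [Perm.inv_eq_iff_eq, hs i hi]

theorem Supp.apply_mem {n : ℕ} {s : Perm ℕ} (hs : Supp n s) {i : ℕ} (hi : 1 ≤ i ∧ i ≤ n) :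
    1 ≤ s i ∧ s i ≤ n := by
  by_contra h
  have := s.injective (hs _ h)
  omega

theorem Rel.eq_of_supp {n : ℕ} {u : Perm ℕ} (hu : Supp n u) {i j : ℕ} (hi : ¬ (1 ≤ i ∧ i ≤ n))
    (h : Rel u i j) : j = i := by
  have h1 := h i
  rw [hu i hi] at h1
  unfold Gap at h1; omega

theorem Below.supp {n : ℕ} {t u : Perm ℕ} (h : Below t u) (hu : Supp n u) : Supp n t :=
  fun i hi => (h i).eq_of_supp hu hi

theorem exists_meet {U : Set (Perm ℕ)} {n : ℕ} {u₀ : Perm ℕ} (hu₀ : u₀ ∈ U) (hn : Supp n u₀) :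
    ∃ m : Perm ℕ, (∀ u ∈ U, Below m u) ∧ ∀ s, (∀ u ∈ U, Below s u) → Below s m := by
  choose f hf hf' using RelAll.exists_next U
  have hsupp : ∀ i, ¬ (1 ≤ i ∧ i ≤ n) → f i = i := fun i hi => (hf i u₀ hu₀).eq_of_supp hn hi
  have hinj : Function.Injective f := by
    intro i j hij
    have h1 : RelAll U i j := fun u hu => (hf i u hu).trans (hij ▸ (hf j u hu).symm)
    have h2 := hf' i j h1
    have h3 := hf' j i fun u hu => (h1 u hu).symm
    rw [← hij] at h3
    unfold Gap at h2 h3; omega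
  have hmaps : ∀ i, (1 ≤ i ∧ i ≤ n) → 1 ≤ f i ∧ f i ≤ n := by
    intro i hi
    by_contra h
    have := hinj (hsupp _ h)
    omega
  have hsurj : Function.Surjective f := by
    intro j
    by_cases hj : 1 ≤ j ∧ j ≤ n
    · have := Finset.surj_on_of_inj_on_of_card_le (s := Finset.Icc 1 n) (t := Finset.Icc 1 n)
        (fun i _ => f i) (fun i hi => by simpa using hmaps i (by simpa using hi))
        (fun _ _ _ _ h => hinj h) le_rfl j (by simpa using hj)
      obtain ⟨i, -, h⟩ := this
      exact ⟨i, h.symm⟩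
    · exact ⟨j, hsupp j hj⟩
  refine ⟨Equiv.ofBijective f ⟨hinj, hsurj⟩, fun u hu j => hf j u hu, fun s hs j k => ?_⟩
  have key : ∀ i j l, RelAll U j l → Gap i (f i) j → Gap i (f i) l := by
    intro i j l hjl hj
    by_contra hl
    exact hf' i j (fun u hu => (hf i u hu).of_crossing (hjl u hu) hj hl) hj
  exact ⟨key k j (s j) fun u hu => hs u hu j, key k (s j) j fun u hu => (hs u hu j).symm⟩

/-- The cycle `(1 2 … n)`. -/
def cyc (n : ℕ) : Perm ℕ where
  toFun i := if 1 ≤ i ∧ i < n then i + 1 else if 1 ≤ i ∧ i = n then 1 else i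
  invFun i := if 2 ≤ i ∧ i ≤ n then i - 1 else if i = 1 ∧ 1 ≤ n then n else i
  left_inv i := by grind
  right_inv i := by grind

theorem cyc_apply (n i : ℕ) :
    cyc n i = if 1 ≤ i ∧ i < n then i + 1 else if 1 ≤ i ∧ i = n then 1 else i := rfl

theorem cyc_supp (n : ℕ) : Supp n (cyc n) := by
  intro i hi
  rw [cyc_apply]; grind

theorem Supp.below_cyc {n : ℕ} {t : Perm ℕ} (ht : Supp n t) : Below t (cyc n) := by
  intro j k
  rw [cyc_apply]
  by_cases hj : 1 ≤ j ∧ j ≤ n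
  · have := ht.apply_mem hj
    unfold Gap; grind
  · rw [ht j hj]

/-- The permutations with noncrossing, cyclically increasing cycles and bounded support. -/
abbrev NC : Type := {t : Perm ℕ // Below t t ∧ ∃ n, Supp n t}

instance : One NC := ⟨1, one_below 1, 0, fun _ _ => rfl⟩

theorem NC.one_val : ((1 : NC) : Perm ℕ) = 1 := rfl

instance : PartialOrder NC where
  le s t := Below s.1 t.1
  le_refl s := s.2.1
  le_trans _ t _ h h' := Below.trans t.2.1 h h'
  le_antisymm _ _ h h' := Subtype.ext (h.antisymm h')

theorem NC.le_def {s t : NC} : s ≤ t ↔ Below s.1 t.1 := Iff.rfl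

theorem NC.one_le (t : NC) : 1 ≤ t := one_below t.1

theorem NC.exists_isLUB (s t : NC) : ∃ m : NC, IsLUB {s, t} m := by
  obtain ⟨n₁, h₁⟩ := s.2.2
  obtain ⟨n₂, h₂⟩ := t.2.2
  have h₁' := (h₁.mono (le_max_left n₁ n₂)).below_cyc
  have h₂' := (h₂.mono (le_max_right n₁ n₂)).below_cyc
  have hc := cyc_supp (max n₁ n₂)
  have hU : cyc (max n₁ n₂) ∈ {u : Perm ℕ | Below u u ∧ Below s.1 u ∧ Below t.1 u} :=
    ⟨hc.below_cyc, h₁', h₂'⟩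
  obtain ⟨m, hm, hm'⟩ := exists_meet hU hc
  refine ⟨⟨m, hm' m hm, _, (hm _ hU).supp hc⟩, ?_, ?_⟩
  · rintro x (rfl | rfl)
    · exact hm' _ fun u hu => hu.2.1
    · exact hm' _ fun u hu => hu.2.2
  · intro u hu
    exact hm u.1 ⟨u.2.1, hu (Set.mem_insert _ _), hu (Set.mem_insert_of_mem _ rfl)⟩

noncomputable instance : SemilatticeSup NC where
  sup s t := (NC.exists_isLUB s t).choose
  le_sup_left s t := (NC.exists_isLUB s t).choose_spec.1 (Set.mem_insert _ _)
  le_sup_right s t := (NC.exists_isLUB s t).choose_spec.1 (Set.mem_insert_of_mem _ rfl)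
  sup_le s t u h h' := (NC.exists_isLUB s t).choose_spec.2 (by
    rintro x (rfl | rfl)
    · exact h
    · exact h')

end DualBraid

namespace DualBraid

/-- A set with a complement operation satisfying the cube law (an `L`-algebra); `res s t` is the
element `x` such that `x * s` is the least common left-multiple of `s` and `t`. -/
class Complemented (S : Type*) extends One S where
  /-- The complement of the second argument after the first one. -/
  res : S → S → S
  res_self : ∀ s, res s s = 1
  res_one : ∀ s, res s 1 = 1
  one_res : ∀ s, res 1 s = s
  cube : ∀ s t u, res (res s t) (res s u) = res (res t s) (res t u)

namespace Complemented

variable {S : Type*} [Complemented S]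

/-- The complement of the word `w` after the letter `s`. -/
def lres : S → List S → List S
  | _, [] => []
  | s, t :: w => res s t :: lres (res t s) w

/-- The complement of the letter `s` after the word `w`. -/
def resl : S → List S → S
  | s, [] => s
  | s, t :: w => resl (res t s) w

/-- The complement of the second word after the first one. Words are read from right to left. -/
def wres : List S → List S → List S
  | [], w => w
  | s :: u, w => wres u (lres s w)

/-- All letters are trivial. -/
def Ones (w : List S) : Prop := ∀ s ∈ w, s = 1

theorem wres_cons (s : S) (u w : List S) : wres (s :: u) w = wres u (lres s w) := rfl

theorem wres_nil (u : List S) : wres u [] = [] := by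
  induction u with
  | nil => rfl
  | cons s u ih => simpa [wres, lres] using ih

theorem lres_one (w : List S) : lres 1 w = w := by
  induction w with
  | nil => rfl
  | cons t w ih => rw [lres, res_one, one_res, ih]

theorem wres_cons_right (v : List S) (s : S) (u : List S) :
    wres v (s :: u) = resl s v :: wres (lres s v) u := by
  induction v generalizing s u with
  | nil => rfl
  | cons t v ih => rw [wres, lres, ih]; rfl

theorem lres_cube (s t : S) (w : List S) :
    lres (res s t) (lres s w) = lres (res t s) (lres t w) := by
  induction w generalizing s t with
  | nil => rfl
  | cons x w ih => simp only [lres]; rw [cube s t x, cube s x t, ih, cube x t s]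

theorem wres_lres_cube (s : S) (v w : List S) :
    wres (lres s v) (lres s w) = lres (resl s v) (wres v w) := by
  induction v generalizing s w with
  | nil => rfl
  | cons t v ih => rw [lres, wres, lres_cube, ih]; rfl

theorem wres_cube (u v w : List S) :
    wres (wres u v) (wres u w) = wres (wres v u) (wres v w) := by
  induction u generalizing v w with
  | nil => rw [wres_nil]; rfl
  | cons s u ih => rw [wres_cons, wres_cons, ih, wres_lres_cube, wres_cons_right, wres_cons]

theorem wres_append (u v w : List S) : wres (u ++ v) w = wres v (wres u w) := by
  induction u generalizing w with
  | nil => rfl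
  | cons s u ih => rw [List.cons_append, wres_cons, ih, wres_cons]

theorem wres_append_right (w u v : List S) :
    wres w (u ++ v) = wres w u ++ wres (wres u w) v := by
  induction u generalizing w with
  | nil => rw [wres_nil]; rfl
  | cons s u ih => rw [List.cons_append, wres_cons_right, wres_cons_right, ih]; rfl

theorem Ones.lres {w : List S} (hw : Ones w) (s : S) : Ones (lres s w) := by
  induction w generalizing s with
  | nil => exact hw
  | cons t w ih =>
    have ht : t = 1 := hw t (by simp)
    subst ht
    rw [Complemented.lres, one_res, res_one]
    have h := ih (fun x hx => hw x (by simp [hx])) s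
    intro x hx
    rcases List.mem_cons.1 hx with rfl | hx
    · rfl
    · exact h x hx

theorem Ones.wres_right {w : List S} (hw : Ones w) (u : List S) : Ones (wres u w) := by
  induction u generalizing w with
  | nil => exact hw
  | cons s u ih => exact ih (hw.lres s)

theorem Ones.wres_left {u : List S} (hu : Ones u) (w : List S) : wres u w = w := by
  induction u with
  | nil => rfl
  | cons s u ih =>
    rw [wres_cons, hu s (by simp), lres_one, ih fun x hx => hu x (by simp [hx])]

theorem ones_append {u v : List S} : Ones (u ++ v) ↔ Ones u ∧ Ones v := by
  simp [Ones, or_imp, forall_and]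

theorem ones_cons {s : S} {v : List S} : Ones (s :: v) ↔ s = 1 ∧ Ones v := by
  simp [Ones]

theorem ones_wres_self (u : List S) : Ones (wres u u) := by
  induction u with
  | nil => intro x hx; cases hx
  | cons s u ih =>
    rw [wres_cons, lres, res_self, lres_one, wres_cons_right, lres_one, ones_cons]
    refine ⟨?_, ih⟩
    clear ih
    induction u with
    | nil => rfl
    | cons t u ih => rw [resl, res_one, ih]

/-- The word `u` represents a right-divisor of what `w` represents. -/
def WDvd (u w : List S) : Prop := Ones (wres w u)

theorem WDvd.refl (u : List S) : WDvd u u := ones_wres_self u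

theorem WDvd.trans {u v w : List S} (h : WDvd u v) (h' : WDvd v w) : WDvd u w := by
  have h1 := wres_cube w v u
  rw [Ones.wres_left h'] at h1
  unfold WDvd
  rw [h1]
  exact h.wres_right _

theorem Ones.wdvd {u : List S} (hu : Ones u) (v : List S) : WDvd u v := hu.wres_right v

theorem wdvd_append (u v : List S) : WDvd u (u ++ v) := by
  rw [WDvd, wres_append]
  exact (ones_wres_self u).wres_right v

theorem WDvd.append {u u' v v' : List S} (h : WDvd u u') (h' : WDvd u' u) (hv : WDvd v v') :
    WDvd (u ++ v) (u' ++ v') := by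
  rw [WDvd, wres_append, wres_append_right, wres_append_right, ones_append, Ones.wres_left h',
    Ones.wres_left h]
  exact ⟨h.wres_right _, hv⟩

theorem wdvd_append_left_iff (u v v' : List S) : WDvd (u ++ v) (u ++ v') ↔ WDvd v v' := by
  refine ⟨fun h => ?_, fun h => (WDvd.refl u).append (WDvd.refl u) h⟩
  have h1 := ones_wres_self u
  rw [WDvd, wres_append, wres_append_right, wres_append_right, ones_append, h1.wres_left,
    h1.wres_left] at h
  exact h.2

theorem append_wres_wdvd {u v w : List S} (hu : WDvd u w) (hv : WDvd v w) :
    WDvd (u ++ wres u v) w := by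
  rw [WDvd, wres_append_right, ones_append, wres_cube, Ones.wres_left hu]
  exact ⟨hu, hv⟩

theorem wdvd_append_wres (u v : List S) : WDvd v (u ++ wres u v) := by
  rw [WDvd, wres_append]; exact ones_wres_self _

/-- The two words represent the same element. -/
def WEquiv (u v : List S) : Prop := WDvd u v ∧ WDvd v u

theorem WEquiv.refl (u : List S) : WEquiv u u := ⟨.refl u, .refl u⟩

theorem WEquiv.symm {u v : List S} (h : WEquiv u v) : WEquiv v u := ⟨h.2, h.1⟩

theorem WEquiv.trans {u v w : List S} (h : WEquiv u v) (h' : WEquiv v w) : WEquiv u w :=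
  ⟨h.1.trans h'.1, h'.2.trans h.2⟩

theorem WEquiv.append {u u' v v' : List S} (h : WEquiv u u') (h' : WEquiv v v') :
    WEquiv (u ++ v) (u' ++ v') := ⟨h.1.append h.2 h'.1, h.2.append h.1 h'.2⟩

theorem WEquiv.append_left_cancel {u v v' : List S} (h : WEquiv (u ++ v) (u ++ v')) :
    WEquiv v v' :=
  ⟨(wdvd_append_left_iff u v v').1 h.1, (wdvd_append_left_iff u v' v).1 h.2⟩

theorem append_wres_equiv (u v : List S) : WEquiv (u ++ wres u v) (v ++ wres v u) :=
  ⟨append_wres_wdvd (wdvd_append_wres v u) (wdvd_append _ _),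
    append_wres_wdvd (wdvd_append_wres u v) (wdvd_append _ _)⟩

theorem Ones.equiv {u v : List S} (hu : Ones u) (hv : Ones v) : WEquiv u v :=
  ⟨hu.wdvd v, hv.wdvd u⟩

theorem WDvd.equiv_append {u w : List S} (h : WDvd u w) : WEquiv w (u ++ wres u w) := by
  have h1 := append_wres_equiv w u
  have h2 : WEquiv (w ++ wres w u) (w ++ []) :=
    (WEquiv.refl w).append (Ones.equiv h fun x hx => by cases hx)
  rw [List.append_nil] at h2
  exact h2.symm.trans h1

variable (S) in
/-- The monoid presented by the complement; the product of the classes of `u` and `v` is the class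
of `v ++ u`. -/
def Mon : Type _ := Quotient (⟨WEquiv, WEquiv.refl, WEquiv.symm, WEquiv.trans⟩ : Setoid (List S))

/-- The class of a word. -/
def mkW (u : List S) : Mon S := Quotient.mk _ u

theorem mkW_eq {u v : List S} : mkW u = mkW v ↔ WEquiv u v :=
  ⟨fun h => Quotient.exact h, fun h => Quotient.sound h⟩

instance : Monoid (Mon S) where
  mul := Quotient.map₂ (fun u v => v ++ u) fun _ _ h _ _ h' => h'.append h
  one := mkW []
  mul_assoc x y z := by
    induction x using Quotient.ind; induction y using Quotient.ind; induction z using Quotient.ind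
    exact mkW_eq.2 (by simpa using WEquiv.refl _)
  one_mul x := by
    induction x using Quotient.ind
    exact mkW_eq.2 (by simpa using WEquiv.refl _)
  mul_one x := by
    induction x using Quotient.ind
    exact mkW_eq.2 (WEquiv.refl _)

theorem mkW_mul (u v : List S) : mkW u * mkW v = mkW (v ++ u) := rfl

theorem mkW_nil : mkW ([] : List S) = 1 := rfl

theorem Mon.ind {p : Mon S → Prop} (h : ∀ u, p (mkW u)) (x : Mon S) : p x := Quotient.ind h x

theorem Mon.mul_right_cancel {x y z : Mon S} : x * z = y * z → x = y := by
  induction x using Mon.ind; induction y using Mon.ind; induction z using Mon.ind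
  rw [mkW_mul, mkW_mul, mkW_eq, mkW_eq]
  exact WEquiv.append_left_cancel

theorem Mon.exists_common_mul (x y : Mon S) : ∃ x' y', x' * x = y' * y := by
  induction x using Mon.ind with | _ u
  induction y using Mon.ind with | _ v
  exact ⟨mkW (wres u v), mkW (wres v u), mkW_eq.2 (append_wres_equiv u v)⟩

end Complemented
end DualBraid

namespace DualBraid

open Equiv Complemented

theorem Below.mul_inv_self {v u : Perm ℕ} (hv : Below v v) (hu : Below u u) (h : Below v u) :
    Below (u * v⁻¹) (u * v⁻¹) := Below.mul_inv_mul_inv hv hu hv h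

theorem Below.mul_inv_right {s t u : Perm ℕ} (hs : Below s s) (ht : Below t t) (hu : Below u u)
    (h : Below s t) (h' : Below t u) : Below (t * s⁻¹) (u * s⁻¹) := by
  have h1 : Below (u * t⁻¹) (u * s⁻¹) := Below.mul_inv_mul_inv ht hu h h'
  have h2 := h1.inv.mul (Below.mul_inv_self hs hu (Below.trans ht h h'))
  convert h2 using 1
  group

theorem Below.mul_right {s u x y : Perm ℕ} (hs : Below s s) (hu : Below u u) (hx : Below x x)
    (hy : Below y y) (h : Below s u) (hxy : Below x y) (hyu : Below y (u * s⁻¹)) :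
    Below (x * s) (y * s) := by
  have hv := Below.mul_inv_self hs hu h
  have hvu : Below (u * s⁻¹) u := hu.mul h.inv
  have hxv := Below.trans hy hxy hyu
  have h1 := Below.mul_inv_mul_inv hy hv hxy hyu
  have h2 := Below.mul_inv_self hx hv hxv
  have h3 : Below (u * s⁻¹ * x⁻¹) u := Below.trans hv (hv.mul hxv.inv) hvu
  have h4 := Below.inv_mul_inv_mul h2 hu h1 h3
  convert h4 using 1 <;> group

namespace NC

/-- The quotient `t s⁻¹` of noncrossing permutations with `s ≤ t`. -/
def div (t s : NC) (h : s ≤ t) : NC :=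
  ⟨t.1 * s.1⁻¹, Below.mul_inv_self s.2.1 t.2.1 h,
    t.2.2.imp fun _ hn => hn.mul (Below.supp h hn).inv⟩

theorem div_le_div {s t u : NC} (h : s ≤ t) (h' : t ≤ u) :
    div t s h ≤ div u s (h.trans h') :=
  Below.mul_inv_right s.2.1 t.2.1 u.2.1 h h'

theorem div_sup_div {s t u : NC} (h : s ≤ t) (h' : s ≤ u) :
    div t s h ⊔ div u s h' = div (t ⊔ u) s (h.trans le_sup_left) := by
  apply le_antisymm
  · refine sup_le (div_le_div h le_sup_left) ?_
    exact div_le_div h' le_sup_right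
  · set J := t ⊔ u
    have hJ : s ≤ J := h.trans le_sup_left
    set w := div t s h ⊔ div u s h' with hw
    have hwJ : w ≤ div J s hJ :=
      sup_le (div_le_div h le_sup_left) (div_le_div h' le_sup_right)
    have key : ∀ x : NC, x ≤ w → Below (x.1 * s.1) (w.1 * s.1) := fun x hx =>
      Below.mul_right s.2.1 J.2.1 x.2.1 w.2.1 hJ hx hwJ
    have hwu : Below (w.1 * s.1) J.1 := by
      have := Below.mul_right s.2.1 J.2.1 w.2.1 (div J s hJ).2.1 hJ hwJ (div J s hJ).2.1
      simpa [div] using this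
    let y : NC := ⟨w.1 * s.1, key w le_rfl, J.2.2.imp fun _ hn => hwu.supp hn⟩
    have h1 : t ≤ y := by
      have := key _ (le_sup_left : div t s h ≤ w)
      rw [le_def]; simpa [div] using this
    have h2 : u ≤ y := by
      have := key _ (le_sup_right : div u s h' ≤ w)
      rw [le_def]; simpa [div] using this
    have h3 : J = y := le_antisymm (sup_le h1 h2) hwu
    apply le_of_eq
    apply Subtype.ext
    change J.1 * s.1⁻¹ = w.1
    rw [h3]
    exact mul_inv_cancel_right _ _

noncomputable instance : Complemented NC where
  res s t := div (s ⊔ t) s le_sup_left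
  res_self s := by
    apply Subtype.ext; simp [div, one_val]
  res_one s := by
    have h : s ⊔ 1 = s := sup_eq_left.2 s.one_le
    apply Subtype.ext; simp [div, one_val, h]
  one_res s := by
    have h : 1 ⊔ s = s := sup_eq_right.2 s.one_le
    apply Subtype.ext; simp [div, one_val, h]
  cube s t u := by
    have h : (s ⊔ t) ⊔ (s ⊔ u) = (t ⊔ s) ⊔ (t ⊔ u) := by
      simp only [sup_left_comm, sup_comm, sup_left_idem]
    apply Subtype.ext
    simp only [div_sup_div, h]
    simp only [div, sup_comm t s]
    group

theorem res_eq (s t : NC) : res s t = div (s ⊔ t) s le_sup_left := rfl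

theorem res_val (s t : NC) : (res s t).1 = (s ⊔ t).1 * s.1⁻¹ := rfl

theorem res_eq_one {s t : NC} : res s t = 1 ↔ t ≤ s := by
  rw [Subtype.ext_iff, res_val, one_val, mul_inv_eq_one, ← Subtype.ext_iff, sup_eq_left]

theorem supp_sup {n : ℕ} {s t : NC} (hs : Supp n s.1) (ht : Supp n t.1) : Supp n (s ⊔ t).1 := by
  let c : NC := ⟨cyc n, (cyc_supp n).below_cyc, n, cyc_supp n⟩
  have h : s ⊔ t ≤ c := sup_le hs.below_cyc ht.below_cyc
  exact Below.supp h (cyc_supp n)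

theorem supp_res {n : ℕ} {s t : NC} (hs : Supp n s.1) (ht : Supp n t.1) :
    Supp n (res s t).1 := (supp_sup hs ht).mul hs.inv

end NC

/-- Words whose letters are supported on `{1, …, n}`. -/
def W (n : ℕ) (u : List NC) : Prop := ∀ s ∈ u, Supp n s.1

theorem W.nil (n : ℕ) : W n [] := fun s hs => by cases hs

theorem w_cons {n : ℕ} {s : NC} {u : List NC} : W n (s :: u) ↔ Supp n s.1 ∧ W n u := by
  simp [W]

theorem w_append {n : ℕ} {u v : List NC} : W n (u ++ v) ↔ W n u ∧ W n v := by
  simp [W, or_imp, forall_and]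

theorem W.mono {m n : ℕ} (h : m ≤ n) {u : List NC} (hu : W m u) : W n u :=
  fun s hs => (hu s hs).mono h

theorem W.lres {n : ℕ} {s : NC} {u : List NC} (hs : Supp n s.1) (hu : W n u) :
    W n (lres s u) := by
  induction u generalizing s with
  | nil => exact hu
  | cons t u ih =>
    rw [w_cons] at hu
    exact w_cons.2 ⟨NC.supp_res hs hu.1, ih (NC.supp_res hu.1 hs) hu.2⟩

theorem W.wres {n : ℕ} {u v : List NC} (hu : W n u) (hv : W n v) : W n (wres u v) := by
  induction u generalizing v with
  | nil => exact hv
  | cons t u ih =>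
    rw [w_cons] at hu
    exact ih hu.2 (hv.lres hu.1)

theorem exists_w (u : List NC) : ∃ n, W n u := by
  induction u with
  | nil => exact ⟨0, W.nil 0⟩
  | cons t u ih =>
    obtain ⟨n, hn⟩ := ih
    obtain ⟨m, hm⟩ := t.2.2
    exact ⟨max m n, w_cons.2 ⟨hm.mono (le_max_left _ _), hn.mono (le_max_right _ _)⟩⟩

/-- The class of a letter. -/
noncomputable def gen (s : NC) : Mon NC := mkW [s]

theorem mkW_cons (s : NC) (u : List NC) : mkW (s :: u) = mkW u * gen s := rfl

theorem gen_mul_gen {q s t : NC} (h : s ≤ t) (hq : q.1 * s.1 = t.1) : gen q * gen s = gen t := by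
  have hq : q = res s t := by
    apply Subtype.ext
    rw [NC.res_val, sup_eq_right.2 h, ← hq, mul_inv_cancel_right]
  subst hq
  have h1 := append_wres_equiv [s] [t]
  have h2 : wres [t] [s] = [1] := by simp [wres, lres, NC.res_eq_one.2 h]
  rw [h2] at h1
  have h3 : WEquiv ([t] ++ [1]) ([t] ++ []) :=
    (WEquiv.refl [t]).append (Ones.equiv (by simp [Ones]) (by simp [Ones]))
  exact mkW_eq.2 (h1.trans h3)

theorem gen_one : gen 1 = 1 := mkW_eq.2 (Ones.equiv (by simp [Ones]) (by simp [Ones]))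

/-- The cycle `(1 2 … n)` as a noncrossing permutation. -/
def cycNC (n : ℕ) : NC := ⟨cyc n, (cyc_supp n).below_cyc, n, cyc_supp n⟩

/-- The rotation of noncrossing permutations supported on `{1, …, n}`. -/
noncomputable def rot (n : ℕ) (s : NC) : NC := by
  classical
  exact if h : Supp n s.1 then ⟨cyc n * (cyc n * s.1⁻¹)⁻¹,
    Below.mul_inv_self (Below.mul_inv_self s.2.1 (cycNC n).2.1 h.below_cyc) (cycNC n).2.1
      ((cyc_supp n).mul h.inv).below_cyc, n, (cyc_supp n).mul ((cyc_supp n).mul h.inv).inv⟩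
  else s

theorem rot_val {n : ℕ} {s : NC} (h : Supp n s.1) : (rot n s).1 = cyc n * s.1 * (cyc n)⁻¹ := by
  rw [rot, dif_pos h]; group

theorem rot_supp {n : ℕ} {s : NC} (h : Supp n s.1) : Supp n (rot n s).1 := by
  rw [rot_val h]; exact ((cyc_supp n).mul h).mul (cyc_supp n).inv

theorem rot_le_rot {n : ℕ} {s t : NC} (hs : Supp n s.1) (ht : Supp n t.1) (h : s ≤ t) :
    rot n s ≤ rot n t := by
  have hc := (cycNC n).2.1
  have h1 := Below.mul_inv_mul_inv t.2.1 hc h ht.below_cyc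
  have h2 := Below.mul_inv_mul_inv (Below.mul_inv_self s.2.1 hc hs.below_cyc) hc h1
    ((cyc_supp n).mul hs.inv).below_cyc
  rw [NC.le_def, rot_val hs, rot_val ht]
  convert h2 using 1 <;> (simp only [cycNC]; group)

theorem exists_rot_eq {n : ℕ} {t : NC} (ht : Supp n t.1) :
    ∃ s : NC, Supp n s.1 ∧ rot n s = t ∧ ∀ r, Supp n r.1 → rot n r ≤ t → r ≤ s := by
  have hc := (cycNC n).2.1
  have aux : ∀ r : Perm ℕ, Below r r → Supp n r → Below r t.1 →
      Below ((r⁻¹ * cyc n)⁻¹ * cyc n) ((t.1⁻¹ * cyc n)⁻¹ * cyc n) := by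
    intro r hr hrs h
    have h1 := Below.inv_mul_inv_mul t.2.1 hc h ht.below_cyc
    exact Below.inv_mul_inv_mul (Below.inv_mul_inv_mul hr hc hr hrs.below_cyc) hc h1
      (hrs.inv.mul (cyc_supp n)).below_cyc
  have hs := (ht.inv.mul (cyc_supp n)).inv.mul (cyc_supp n)
  refine ⟨⟨_, aux t.1 t.2.1 ht t.2.1, n, hs⟩, hs, ?_, ?_⟩
  · apply Subtype.ext
    rw [rot_val hs]
    group
  · intro r hr h
    have := aux _ (rot n r).2.1 (rot_supp hr) h
    rw [NC.le_def]
    convert this using 1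
    rw [rot_val hr]
    group

theorem rot_inj {n : ℕ} {s t : NC} (hs : Supp n s.1) (ht : Supp n t.1) (h : rot n s = rot n t) :
    s = t := by
  have h1 := congrArg Subtype.val h
  rw [rot_val hs, rot_val ht] at h1
  exact Subtype.ext (mul_left_cancel (mul_right_cancel h1))

theorem rot_sup {n : ℕ} {s t : NC} (hs : Supp n s.1) (ht : Supp n t.1) :
    rot n (s ⊔ t) = rot n s ⊔ rot n t := by
  have hst := NC.supp_sup hs ht
  apply le_antisymm
  · obtain ⟨r, hr, hrr, hr'⟩ := exists_rot_eq (NC.supp_sup (rot_supp hs) (rot_supp ht))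
    rw [← hrr]
    exact rot_le_rot hst hr (sup_le (hr' s hs le_sup_left) (hr' t ht le_sup_right))
  · exact sup_le (rot_le_rot hs hst le_sup_left) (rot_le_rot ht hst le_sup_right)

theorem rot_one (n : ℕ) : rot n 1 = 1 := by
  apply Subtype.ext
  rw [rot_val (fun _ _ => rfl)]
  simp [NC.one_val]

theorem rot_res {n : ℕ} {s t : NC} (hs : Supp n s.1) (ht : Supp n t.1) :
    rot n (res s t) = res (rot n s) (rot n t) := by
  apply Subtype.ext
  rw [rot_val (NC.supp_res hs ht), NC.res_val, NC.res_val, ← rot_sup hs ht,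
    rot_val (NC.supp_sup hs ht), rot_val hs]
  group

theorem W.rot {n : ℕ} {u : List NC} (hu : W n u) : W n (u.map (rot n)) := by
  intro s hs
  obtain ⟨t, ht, rfl⟩ := List.mem_map.1 hs
  exact rot_supp (hu t ht)

theorem map_rot_lres {n : ℕ} {s : NC} {u : List NC} (hs : Supp n s.1) (hu : W n u) :
    (lres s u).map (rot n) = lres (rot n s) (u.map (rot n)) := by
  induction u generalizing s with
  | nil => rfl
  | cons t u ih =>
    rw [w_cons] at hu
    simp only [lres, List.map_cons]
    rw [rot_res hs hu.1, ih (NC.supp_res hu.1 hs) hu.2, rot_res hu.1 hs]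

theorem map_rot_wres {n : ℕ} {u v : List NC} (hu : W n u) (hv : W n v) :
    (wres u v).map (rot n) = wres (u.map (rot n)) (v.map (rot n)) := by
  induction u generalizing v with
  | nil => rfl
  | cons t u ih =>
    rw [w_cons] at hu
    rw [wres, ih hu.2 (hv.lres hu.1), map_rot_lres hu.1 hv]; rfl

theorem wdvd_map_rot_iff {n : ℕ} {u v : List NC} (hu : W n u) (hv : W n v) :
    WDvd (u.map (rot n)) (v.map (rot n)) ↔ WDvd u v := by
  unfold WDvd
  rw [← map_rot_wres hv hu]
  have hw := hv.wres hu
  constructor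
  · intro h s hs
    exact rot_inj (hw s hs) (fun _ _ => rfl) ((h _ (List.mem_map_of_mem hs)).trans (rot_one n).symm)
  · intro h s hs
    obtain ⟨t, ht, rfl⟩ := List.mem_map.1 hs
    rw [h t ht, rot_one]

theorem mkW_map_rot_eq_iff {n : ℕ} {u v : List NC} (hu : W n u) (hv : W n v) :
    mkW (u.map (rot n)) = mkW (v.map (rot n)) ↔ mkW u = mkW v := by
  rw [mkW_eq, mkW_eq, WEquiv, WEquiv, wdvd_map_rot_iff hu hv, wdvd_map_rot_iff hv hu]

theorem cyc_mul_gen {n : ℕ} {s : NC} (hs : Supp n s.1) :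
    gen (cycNC n) * gen s = gen (rot n s) * gen (cycNC n) := by
  have h : s ≤ cycNC n := hs.below_cyc
  have hd : Supp n (NC.div (cycNC n) s h).1 := (cyc_supp n).mul hs.inv
  have h1 : gen (NC.div (cycNC n) s h) * gen s = gen (cycNC n) :=
    gen_mul_gen h (inv_mul_cancel_right _ _)
  have h2 : gen (rot n s) * gen (NC.div (cycNC n) s h) = gen (cycNC n) := by
    refine gen_mul_gen hd.below_cyc ?_
    rw [rot_val hs]
    simp [NC.div, cycNC]
  conv_rhs => rw [← h1, ← mul_assoc, h2]

theorem cyc_mul_mkW {n : ℕ} {u : List NC} (hu : W n u) :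
    gen (cycNC n) * mkW u = mkW (u.map (rot n)) * gen (cycNC n) := by
  induction u with
  | nil => simp [mkW_nil]
  | cons s u ih =>
    rw [w_cons] at hu
    rw [mkW_cons, ← mul_assoc, ih hu.2, mul_assoc, cyc_mul_gen hu.1, List.map_cons, mkW_cons,
      mul_assoc]

theorem cyc_left_cancel {n : ℕ} {u v : List NC} (hu : W n u) (hv : W n v)
    (h : gen (cycNC n) * mkW u = gen (cycNC n) * mkW v) : mkW u = mkW v := by
  rw [cyc_mul_mkW hu, cyc_mul_mkW hv] at h
  exact (mkW_map_rot_eq_iff hu hv).1 (Mon.mul_right_cancel h)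

theorem cyc_pow_left_cancel {n : ℕ} (k : ℕ) {u v : List NC} (hu : W n u) (hv : W n v)
    (h : gen (cycNC n) ^ k * mkW u = gen (cycNC n) ^ k * mkW v) : mkW u = mkW v := by
  induction k generalizing u v with
  | zero => simpa using h
  | succ k ih =>
    have hc : W n [cycNC n] := w_cons.2 ⟨cyc_supp n, W.nil n⟩
    rw [pow_succ, mul_assoc, mul_assoc] at h
    exact cyc_left_cancel hu hv (ih (u := u ++ [cycNC n]) (v := v ++ [cycNC n])
      (w_append.2 ⟨hu, hc⟩) (w_append.2 ⟨hv, hc⟩) h)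

theorem exists_mul_eq_cyc_pow {n : ℕ} {u : List NC} (hu : W n u) :
    ∃ (v : List NC) (k : ℕ), W n v ∧ mkW v * mkW u = gen (cycNC n) ^ k := by
  have step : ∀ (k : ℕ) (s : NC), Supp n s.1 →
      ∃ t : NC, Supp n t.1 ∧ gen t * gen (cycNC n) ^ k * gen s = gen (cycNC n) ^ (k + 1) := by
    intro k
    induction k with
    | zero =>
      intro s hs
      refine ⟨NC.div (cycNC n) s hs.below_cyc, (cyc_supp n).mul hs.inv, ?_⟩
      simpa using gen_mul_gen (t := cycNC n) hs.below_cyc (inv_mul_cancel_right _ _)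
    | succ k ih =>
      intro s hs
      obtain ⟨t, ht, h⟩ := ih (rot n s) (rot_supp hs)
      refine ⟨t, ht, ?_⟩
      have e : gen (cycNC n) ^ (k + 1) * gen s =
          gen (cycNC n) ^ k * gen (rot n s) * gen (cycNC n) := by
        rw [pow_succ, mul_assoc, cyc_mul_gen hs, mul_assoc]
      rw [mul_assoc, e, pow_succ _ (k + 1), ← h]
      simp only [mul_assoc]
  induction u with
  | nil => exact ⟨[], 0, W.nil n, rfl⟩
  | cons s u ih =>
    rw [w_cons] at hu
    obtain ⟨v, k, hv, h⟩ := ih hu.2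
    obtain ⟨t, ht, h'⟩ := step k s hu.1
    refine ⟨v ++ [t], k + 1, w_append.2 ⟨hv, w_cons.2 ⟨ht, W.nil n⟩⟩, ?_⟩
    change (gen t * mkW v) * _ = _
    rw [mkW_cons, ← h', ← h]
    simp only [mul_assoc]

theorem mon_left_cancel {x y z : Mon NC} : z * x = z * y → x = y := by
  induction x using Mon.ind with | _ u
  induction y using Mon.ind with | _ v
  induction z using Mon.ind with | _ w
  intro h
  obtain ⟨n₁, h₁⟩ := exists_w (w ++ (u ++ v))
  rw [w_append, w_append] at h₁
  obtain ⟨w', k, -, hk⟩ := exists_mul_eq_cyc_pow h₁.1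
  apply cyc_pow_left_cancel k h₁.2.1 h₁.2.2
  rw [← hk, mul_assoc, mul_assoc, h]

/-- Any two elements have a common left-multiple. -/
noncomputable instance : OreLocalization.OreSet (⊤ : Submonoid (Mon NC)) where
  ore_right_cancel _ _ _ h := ⟨1, by rw [Mon.mul_right_cancel h]⟩
  oreNum r s := (Mon.exists_common_mul r s.1).choose_spec.choose
  oreDenom r s := ⟨(Mon.exists_common_mul r s.1).choose, trivial⟩
  ore_eq r s := (Mon.exists_common_mul r s.1).choose_spec.choose_spec

/-- The group of units of the monoid of left fractions. -/
abbrev Frac : Type := (OreLocalization (⊤ : Submonoid (Mon NC)) (Mon NC))ˣ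

/-- The embedding of the monoid of noncrossing words in its group of fractions. -/
noncomputable def toFrac : Mon NC →* Frac where
  toFun x := OreLocalization.numeratorUnit ⟨x, trivial⟩
  map_one' := Units.ext (map_one OreLocalization.numeratorHom)
  map_mul' x y := Units.ext (map_mul OreLocalization.numeratorHom x y)

theorem toFrac_injective : Function.Injective toFrac := by
  intro x y h
  have h1 := congrArg Units.val h
  obtain ⟨u, v, h2, h3⟩ := OreLocalization.oreDiv_eq_iff.1 h1
  have h4 : (u : Mon NC) = v := by simpa using h3
  rw [Submonoid.smul_def, h4] at h2
  exact (mon_left_cancel h2).symm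

end DualBraid

namespace DualBraid

theorem σ_eq {n i : ℕ} (h : 1 ≤ i ∧ i < n) : σ n i = PresentedGroup.of ⟨i, h⟩ := dif_pos h

theorem σ_commute {n i j : ℕ} (hi : 1 ≤ i) (hij : i + 2 ≤ j) (hj : j < n) :
    Commute (σ n i) (σ n j) := by
  rw [σ_eq ⟨hi, by omega⟩, σ_eq ⟨by omega, hj⟩]
  have h : PresentedGroup.mk (artinRels n) _ = 1 := PresentedGroup.one_of_mem
    (Or.inl ⟨⟨i, hi, by omega⟩, ⟨j, by omega, hj⟩, Or.inl hij, rfl⟩)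
  rw [map_mul, map_inv, mul_inv_eq_one, map_mul, map_mul] at h
  exact h

theorem σ_braid {n i : ℕ} (hi : 1 ≤ i) (hn : i + 1 < n) :
    σ n i * σ n (i + 1) * σ n i = σ n (i + 1) * σ n i * σ n (i + 1) := by
  rw [σ_eq ⟨hi, by omega⟩, σ_eq ⟨by omega, hn⟩]
  have h : PresentedGroup.mk (artinRels n) _ = 1 := PresentedGroup.one_of_mem
    (Or.inr ⟨⟨i, hi, by omega⟩, ⟨i + 1, by omega, hn⟩, Or.inl rfl, rfl⟩)
  rw [map_mul, map_inv, mul_inv_eq_one, map_mul, map_mul, map_mul, map_mul] at h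
  exact h

theorem a_self_succ (n p : ℕ) : a n p (p + 1) = σ n p := by
  simp [a, sigmaProd]

theorem a_eq_conj {n p q : ℕ} (h : p + 1 < q) :
    a n p q = σ n p * a n (p + 1) q * (σ n p)⁻¹ := by
  have h1 : sigmaProd n p (q - 1) = σ n p * sigmaProd n (p + 1) (q - 1) := by
    rw [sigmaProd, List.Ico.eq_cons (by omega)]; rfl
  rw [a, h1, a]
  group

theorem commute_a_of_forall {n p q : ℕ} (hpq : p < q) {g : B n}
    (h : ∀ j, p ≤ j → j < q → Commute g (σ n j)) : Commute g (a n p q) := by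
  obtain ⟨d, rfl⟩ : ∃ d, q = p + 1 + d := ⟨q - (p + 1), by omega⟩
  induction d generalizing p with
  | zero => rw [Nat.add_zero, a_self_succ]; exact h p le_rfl (by omega)
  | succ d ih =>
    have h0 := h p le_rfl (by omega)
    have h1 := ih (p := p + 1) (by omega) fun j hj hj' => h j (by omega) (by omega)
    rw [show p + 1 + (d + 1) = p + 1 + 1 + d by omega, a_eq_conj (by omega)]
    exact (h0.mul_right h1).mul_right h0.inv_right

theorem a_commute_of_lt {n p q r s : ℕ} (hp : 1 ≤ p) (hpq : p < q) (hqr : q < r) (hrs : r < s)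
    (hs : s ≤ n) : Commute (a n p q) (a n r s) :=
  commute_a_of_forall hrs fun _ _ _ => (commute_a_of_forall hpq fun _ _ _ =>
    (σ_commute (by omega) (by omega) (by omega)).symm).symm

theorem σ_commute_a {n p q j : ℕ} (hp : 1 ≤ p) (hpj : p < j) (hjq : j + 1 < q) (hq : q ≤ n) :
    Commute (σ n j) (a n p q) := by
  obtain ⟨d, rfl⟩ : ∃ d, j = p + 1 + d := ⟨j - (p + 1), by omega⟩
  induction d generalizing p with
  | zero =>
    have h1 : Commute (σ n p) (a n (p + 1 + 1) q) := commute_a_of_forall (by omega)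
      fun j _ _ => σ_commute hp (by omega) (by omega)
    have h2 := σ_braid (n := n) hp (by omega)
    set x := a n (p + 1 + 1) q
    have h3 : (σ n p * σ n (p + 1)) * σ n p * (σ n p * σ n (p + 1))⁻¹ = σ n (p + 1) := by
      rw [h2]; group
    rw [Nat.add_zero, a_eq_conj (by omega), a_eq_conj (by omega)]
    have h4 := (Commute.conj_iff (σ n p * σ n (p + 1))).2 h1
    rw [h3] at h4
    convert h4 using 1
    simp only [x, mul_assoc, mul_inv_rev]
  | succ d ih =>
    have h0 : Commute (σ n (p + 1 + (d + 1))) (σ n p) :=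
      (σ_commute hp (by omega) (by omega)).symm
    have h1 := ih (p := p + 1) (by omega) (by omega) (by omega)
    rw [show p + 1 + 1 + d = p + 1 + (d + 1) by omega] at h1
    rw [a_eq_conj (by omega)]
    exact (h0.mul_right h1).mul_right h0.inv_right

theorem a_commute_of_nested {n p q r s : ℕ} (hp : 1 ≤ p) (hpr : p < r) (hrs : r < s) (hsq : s < q)
    (hq : q ≤ n) : Commute (a n p q) (a n r s) :=
  commute_a_of_forall hrs fun _ _ _ => (σ_commute_a hp (by omega) (by omega) hq).symm

theorem a_eq_conj_right {n p q : ℕ} (hp : 1 ≤ p) (h : p < q) (hq : q < n) :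
    a n p (q + 1) = (σ n q)⁻¹ * a n p q * σ n q := by
  obtain ⟨d, rfl⟩ : ∃ d, q = p + 1 + d := ⟨q - (p + 1), by omega⟩
  induction d generalizing p with
  | zero =>
    rw [a_eq_conj (by omega), Nat.add_zero, a_self_succ, a_self_succ, mul_inv_eq_iff_eq_mul,
      mul_assoc, mul_assoc, eq_inv_mul_iff_mul_eq, ← mul_assoc, ← mul_assoc]
    exact (σ_braid hp (by omega)).symm
  | succ d ih =>
    have h0 : Commute (σ n p) (σ n (p + 1 + (d + 1))) := σ_commute hp (by omega) (by omega)
    have h1 := ih (p := p + 1) (by omega) (by omega) (by omega)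
    rw [show p + 1 + 1 + d = p + 1 + (d + 1) by omega] at h1
    rw [a_eq_conj (by omega), h1, a_eq_conj (p := p) (by omega)]
    have h2 := h0.inv_right.eq
    have h3 := h0.inv_left.eq
    rw [← mul_assoc, ← mul_assoc, h2, mul_assoc _ (σ n _) (σ n p)⁻¹, ← h3]
    simp only [mul_assoc]

theorem σ_braid_a {n p r : ℕ} (hp : 1 ≤ p) (h : p + 1 < r) (hr : r ≤ n) :
    σ n p * a n (p + 1) r * σ n p = a n (p + 1) r * σ n p * a n (p + 1) r := by
  obtain ⟨d, rfl⟩ : ∃ d, r = p + 1 + 1 + d := ⟨r - (p + 1 + 1), by omega⟩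
  induction d with
  | zero => rw [Nat.add_zero, a_self_succ]; exact σ_braid hp (by omega)
  | succ d ih =>
    have h1 := ih (by omega) (by omega)
    have h0 : Commute (σ n p) (σ n (p + 1 + 1 + d)) := σ_commute hp (by omega) (by omega)
    rw [← Nat.add_assoc, a_eq_conj_right (by omega) (by omega) (by omega)]
    set x := σ n p
    set y := a n (p + 1) (p + 1 + 1 + d)
    set z := σ n (p + 1 + 1 + d)
    have hx : x = z⁻¹ * x * z := by rw [mul_assoc, h0.eq, inv_mul_cancel_left]
    calc x * (z⁻¹ * y * z) * x = (z⁻¹ * x * z) * (z⁻¹ * y * z) * (z⁻¹ * x * z) := by rw [← hx]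
      _ = z⁻¹ * (x * y * x) * z := by group
      _ = (z⁻¹ * y * z) * (z⁻¹ * x * z) * (z⁻¹ * y * z) := by rw [h1]; group
      _ = _ := by rw [← hx]

theorem σ_commute_a_of_lt {n p q r : ℕ} (hp : 1 ≤ p) (hpq : p + 1 < q) (hqr : q < r)
    (hr : r ≤ n) : Commute (σ n p) (a n q r) :=
  commute_a_of_forall hqr fun _ _ _ => σ_commute hp (by omega) (by omega)

theorem a_triangle {n p q r : ℕ} (hp : 1 ≤ p) (hpq : p < q) (hqr : q < r) (hr : r ≤ n) :
    a n p r * a n p q = a n p q * a n q r := by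
  obtain ⟨d, rfl⟩ : ∃ d, q = p + 1 + d := ⟨q - (p + 1), by omega⟩
  induction d generalizing p with
  | zero => rw [Nat.add_zero, a_self_succ, a_eq_conj (by omega), inv_mul_cancel_right]
  | succ d ih =>
    have h1 := ih (p := p + 1) (by omega) (by omega) (by omega)
    have h0 := σ_commute_a_of_lt (n := n) (p := p) (q := p + 1 + (d + 1)) (r := r) hp (by omega)
      hqr hr
    rw [show p + 1 + 1 + d = p + 1 + (d + 1) by omega] at h1
    rw [a_eq_conj (q := r) (by omega), a_eq_conj (p := p) (q := p + 1 + (d + 1)) (by omega),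
      mul_assoc _ _ (a n (p + 1 + (d + 1)) r), h0.inv_left.eq, ← mul_assoc _ (a n _ _) (σ n p)⁻¹,
      mul_assoc _ (a n _ _) (a n _ _), ← h1]
    group

theorem a_triangle' {n p q r : ℕ} (hp : 1 ≤ p) (hpq : p < q) (hqr : q < r) (hr : r ≤ n) :
    a n p q * a n q r = a n q r * a n p r := by
  obtain ⟨d, rfl⟩ : ∃ d, q = p + 1 + d := ⟨q - (p + 1), by omega⟩
  induction d generalizing p with
  | zero =>
    rw [Nat.add_zero, a_self_succ, a_eq_conj (p := p) (by omega), ← mul_assoc, ← mul_assoc,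
      eq_mul_inv_iff_mul_eq]
    exact σ_braid_a hp (by omega) hr
  | succ d ih =>
    have h1 := ih (p := p + 1) (by omega) (by omega) (by omega)
    have h0 := σ_commute_a_of_lt (n := n) (p := p) (q := p + 1 + (d + 1)) (r := r) hp (by omega)
      hqr hr
    rw [show p + 1 + 1 + d = p + 1 + (d + 1) by omega] at h1
    rw [a_eq_conj (p := p) (q := r) (by omega), a_eq_conj (p := p) (q := p + 1 + (d + 1)) (by omega),
      mul_assoc _ _ (a n (p + 1 + (d + 1)) r), h0.inv_left.eq, ← mul_assoc _ (a n _ _) (σ n p)⁻¹,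
      mul_assoc _ (a n _ _) (a n _ _), h1, ← mul_assoc (a n _ r) _ (σ n p)⁻¹,
      ← mul_assoc (a n _ r) (σ n p), ← h0.eq]
    group

end DualBraid

namespace DualBraid

open Equiv Complemented

theorem swap_rel {t : Perm ℕ} {p q : ℕ} : Below (swap p q) t ↔ Rel t p q := by
  constructor
  · intro h
    have := h p
    rwa [swap_apply_left] at this
  · intro h j
    rw [swap_apply_def]
    split_ifs with h1 h2
    · exact h1 ▸ h
    · exact h2 ▸ h.symm
    · exact Rel.refl t j

theorem below_swap_self (p q : ℕ) : Below (swap p q) (swap p q) := by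
  rw [swap_rel]
  intro k
  rw [swap_apply_def]
  unfold Gap; grind

theorem supp_swap {n p q : ℕ} (hp : 1 ≤ p ∧ p ≤ n) (hq : 1 ≤ q ∧ q ≤ n) : Supp n (swap p q) := by
  intro i hi
  exact swap_apply_of_ne_of_ne (by omega) (by omega)

/-- The transposition `(p q)` as a noncrossing permutation. -/
def swapNC (p q : ℕ) : NC :=
  if h : 1 ≤ p ∧ 1 ≤ q then ⟨swap p q, below_swap_self p q, max p q,
    supp_swap ⟨h.1, le_max_left _ _⟩ ⟨h.2, le_max_right _ _⟩⟩ else 1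

theorem swapNC_val {p q : ℕ} (hp : 1 ≤ p) (hq : 1 ≤ q) : (swapNC p q).1 = swap p q := by
  rw [swapNC, dif_pos ⟨hp, hq⟩]

theorem supp_swapNC {n p q : ℕ} (hp : 1 ≤ p) (hq : 1 ≤ q) (hp' : p ≤ n) (hq' : q ≤ n) :
    Supp n (swapNC p q).1 := by
  rw [swapNC_val hp hq]; exact supp_swap ⟨hp, hp'⟩ ⟨hq, hq'⟩

theorem swapNC_le {p q : ℕ} (hp : 1 ≤ p) (hq : 1 ≤ q) {t : NC} : swapNC p q ≤ t ↔ Rel t.1 p q := by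
  rw [NC.le_def, swapNC_val hp hq, swap_rel]

theorem gen_swap_triangle {p q r : ℕ} (hp : 1 ≤ p) (hpq : p < q) (hqr : q < r) :
    gen (swapNC p r) * gen (swapNC p q) = gen (swapNC p q) * gen (swapNC q r) ∧
    gen (swapNC p q) * gen (swapNC q r) = gen (swapNC q r) * gen (swapNC p r) := by
  have hv : ∀ k, (swap p q * swap q r : Perm ℕ) k =
      if k = p then q else if k = q then r else if k = r then p else k := by
    intro k
    rw [Perm.mul_apply, swap_apply_def, swap_apply_def]
    grind
  have hself : Below (swap p q * swap q r) (swap p q * swap q r) := by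
    intro j k
    rw [hv, hv]
    unfold Gap; grind
  have hsupp : Supp r (swap p q * swap q r) :=
    (supp_swap ⟨hp, by omega⟩ ⟨by omega, by omega⟩).mul
      (supp_swap ⟨by omega, by omega⟩ ⟨by omega, by omega⟩)
  let t : NC := ⟨swap p q * swap q r, hself, r, hsupp⟩
  have hpq' : Rel t.1 p q := by
    have := hself p
    rw [hv, if_pos rfl] at this
    exact this
  have hqr' : Rel t.1 q r := by
    have := hself q
    rw [hv, if_neg (by omega), if_pos rfl] at this
    exact this
  have h1 : gen (swapNC p r) * gen (swapNC p q) = gen t := by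
    refine gen_mul_gen ((swapNC_le hp (by omega)).2 hpq') ?_
    rw [swapNC_val hp (by omega), swapNC_val hp (by omega)]
    ext k
    change _ = (swap p q * swap q r : Perm ℕ) k
    rw [hv, Perm.mul_apply, swap_apply_def, swap_apply_def]
    grind
  have h2 : gen (swapNC p q) * gen (swapNC q r) = gen t := by
    refine gen_mul_gen ((swapNC_le (by omega) (by omega)).2 hqr') ?_
    rw [swapNC_val hp (by omega), swapNC_val (by omega) (by omega)]
  have h3 : gen (swapNC q r) * gen (swapNC p r) = gen t := by
    refine gen_mul_gen ((swapNC_le (by omega) (by omega)).2 (hpq'.trans hqr')) ?_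
    rw [swapNC_val hp (by omega), swapNC_val (by omega) (by omega)]
    ext k
    change _ = (swap p q * swap q r : Perm ℕ) k
    rw [hv, Perm.mul_apply, swap_apply_def, swap_apply_def]
    grind
  exact ⟨h1.trans h2.symm, h2.trans h3.symm⟩

theorem gen_swap_commute {p q r s : ℕ} (hp : 1 ≤ p) (hpq : p < q) (hqr : q < r) (hrs : r < s) :
    Commute (gen (swapNC p q)) (gen (swapNC r s)) := by
  have hv : ∀ k, (swap p q * swap r s : Perm ℕ) k =
      if k = p then q else if k = q then p else if k = r then s else if k = s then r else k := by
    intro k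
    rw [Perm.mul_apply, swap_apply_def, swap_apply_def]
    grind
  have hself : Below (swap p q * swap r s) (swap p q * swap r s) := by
    intro j k
    rw [hv, hv]
    unfold Gap; grind
  have hsupp : Supp s (swap p q * swap r s) :=
    (supp_swap ⟨hp, by omega⟩ ⟨by omega, by omega⟩).mul
      (supp_swap ⟨by omega, by omega⟩ ⟨by omega, by omega⟩)
  let t : NC := ⟨swap p q * swap r s, hself, s, hsupp⟩
  have hpq' : Rel t.1 p q := by
    have := hself p
    rw [hv, if_pos rfl] at this
    exact this
  have hrs' : Rel t.1 r s := by
    have := hself r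
    rw [hv, if_neg (by omega), if_neg (by omega), if_pos rfl] at this
    exact this
  have h1 : gen (swapNC p q) * gen (swapNC r s) = gen t := by
    refine gen_mul_gen ((swapNC_le (by omega) (by omega)).2 hrs') ?_
    rw [swapNC_val hp (by omega), swapNC_val (by omega) (by omega)]
  have h2 : gen (swapNC r s) * gen (swapNC p q) = gen t := by
    refine gen_mul_gen ((swapNC_le (by omega) (by omega)).2 hpq') ?_
    rw [swapNC_val hp (by omega), swapNC_val (by omega) (by omega)]
    ext k
    change _ = (swap p q * swap r s : Perm ℕ) k
    rw [hv, Perm.mul_apply, swap_apply_def, swap_apply_def]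
    grind
  exact h1.trans h2.symm

/-- The image of `σᵢ` in the group of fractions. -/
noncomputable def sg (i : ℕ) : Frac := toFrac (gen (swapNC i (i + 1)))

theorem sg_braid {i : ℕ} (hi : 1 ≤ i) : sg i * sg (i + 1) * sg i = sg (i + 1) * sg i * sg (i + 1) := by
  obtain ⟨h1, h2⟩ := gen_swap_triangle hi (Nat.lt_succ_self i) (Nat.lt_succ_self (i + 1))
  simp only [sg, ← map_mul]
  rw [h2, mul_assoc, h1, mul_assoc]

theorem sg_rels (n : ℕ) : ∀ r ∈ artinRels n, FreeGroup.lift (fun i : Idx n => sg i.1) r = 1 := by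
  rintro r (⟨⟨i, hi⟩, ⟨j, hj⟩, hij, rfl⟩ | ⟨⟨i, hi⟩, ⟨j, hj⟩, hij, rfl⟩)
  · simp only [map_mul, map_inv, FreeGroup.lift_apply_of]
    rw [mul_inv_eq_one, sg, sg, ← map_mul, ← map_mul]
    congr 1
    rcases hij with hij | hij <;> dsimp only at hij ⊢
    · exact (gen_swap_commute hi.1 (by omega) (by omega) (by omega)).eq
    · exact (gen_swap_commute hj.1 (by omega) (by omega) (by omega)).eq.symm
  · simp only [map_mul, map_inv, FreeGroup.lift_apply_of]
    rw [mul_inv_eq_one]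
    rcases hij with rfl | rfl
    · exact sg_braid hi.1
    · exact (sg_braid hj.1).symm

/-- The homomorphism from the braid group to the group of fractions of the dual monoid. -/
noncomputable def toF (n : ℕ) : B n →* Frac := PresentedGroup.toGroup (sg_rels n)

theorem toF_σ {n i : ℕ} (h : 1 ≤ i ∧ i < n) : toF n (σ n i) = sg i := by
  rw [σ_eq h]; exact PresentedGroup.toGroup.of (sg_rels n)

theorem toF_a {n p q : ℕ} (hp : 1 ≤ p) (hpq : p < q) (hq : q ≤ n) :
    toF n (a n p q) = toFrac (gen (swapNC p q)) := by
  obtain ⟨d, rfl⟩ : ∃ d, q = p + 1 + d := ⟨q - (p + 1), by omega⟩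
  induction d generalizing p with
  | zero => rw [Nat.add_zero, a_self_succ, toF_σ ⟨hp, by omega⟩]; rfl
  | succ d ih =>
    have h1 := ih (p := p + 1) (by omega) (by omega) (by omega)
    rw [show p + 1 + 1 + d = p + 1 + (d + 1) by omega] at h1
    rw [a_eq_conj (by omega), map_mul, map_mul, map_inv, h1, toF_σ ⟨hp, by omega⟩,
      mul_inv_eq_iff_eq_mul, sg, ← map_mul, ← map_mul]
    congr 1
    exact (gen_swap_triangle hp (by omega) (by omega)).1.symm

end DualBraid

namespace DualBraid

open Equiv Complemented

/-- The contribution of the arc `i → j` to the braid of a noncrossing permutation. -/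
def arc (n i j : ℕ) : B n := if i < j then a n i j else 1

/-- The product of the arcs starting in `{l, …, m - 1}`. -/
def arcs (n : ℕ) (t : Perm ℕ) (l m : ℕ) : B n :=
  ((List.Ico l m).map fun i => arc n i (t i)).prod

/-- The braid of a noncrossing permutation. -/
def braid (n : ℕ) (t : NC) : B n := arcs n t.1 1 (n + 1)

theorem arcs_self (n : ℕ) (t : Perm ℕ) (l : ℕ) : arcs n t l l = 1 := by simp [arcs]

theorem arcs_mul {n : ℕ} {t : Perm ℕ} {l m k : ℕ} (h : l ≤ m) (h' : m ≤ k) :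
    arcs n t l m * arcs n t m k = arcs n t l k := by
  rw [arcs, arcs, arcs, ← List.Ico.append_consecutive h h', List.map_append, List.prod_append]

theorem arcs_succ (n : ℕ) (t : Perm ℕ) (l : ℕ) : arcs n t l (l + 1) = arc n l (t l) := by
  simp [arcs]

theorem arcs_congr {n : ℕ} {s t : Perm ℕ} {l m : ℕ} (h : ∀ i, l ≤ i → i < m → s i = t i) :
    arcs n s l m = arcs n t l m := by
  unfold arcs
  congr 1
  refine List.map_congr_left fun i hi => ?_
  rw [List.Ico.mem] at hi
  rw [h i hi.1 hi.2]

theorem commute_arcs {n : ℕ} {t : Perm ℕ} {l m : ℕ} {x : B n}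
    (h : ∀ i, l ≤ i → i < m → i < t i → Commute x (a n i (t i))) : Commute x (arcs n t l m) := by
  apply Commute.list_prod_right
  intro y hy
  obtain ⟨i, hi, rfl⟩ := List.mem_map.1 hy
  rw [List.Ico.mem] at hi
  dsimp only [arc]
  split_ifs with h'
  · exact h i hi.1 hi.2 h'
  · exact Commute.one_right x

section

variable {n : ℕ} {t : Perm ℕ} {p q : ℕ}

theorem Rel.apply_le (h : Rel t p q) (hpq : p < q) : p < t p ∧ t p ≤ q := by
  have h1 := h p
  unfold Gap at h1; omega

theorem Rel.apply_gt_or_le (h : Rel t p q) : q < t q ∨ t q ≤ p := by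
  have h1 := h q
  unfold Gap at h1; omega

theorem Rel.apply_le_of_between (h : Rel t p q) {i : ℕ} (hi : p < i) (hiq : i < q)
    (hti : i < t i) : t i ≤ q := by
  have h1 := h i
  unfold Gap at h1; omega

theorem arc_mul_arcs (ht : Below t t) (h : Rel t p q) (hp : 1 ≤ p) (hpq : p < q) (hq : q ≤ n) :
    a n p (t p) * arcs n t (p + 1) q = arcs n t (p + 1) q * a n p q := by
  have key : ∀ d, p + 1 + d ≤ q → ∃ m k, p + 1 + d ≤ m ∧ m ≤ q ∧ p ≤ k ∧ k < p + 1 + d ∧ t k = m ∧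
      Rel t p m ∧ a n p (t p) * arcs n t (p + 1) (p + 1 + d) =
        arcs n t (p + 1) (p + 1 + d) * a n p m := by
    intro d
    induction d with
    | zero =>
      intro _
      have h1 := h.apply_le hpq
      refine ⟨t p, p, by omega, by omega, le_rfl, by omega, rfl, ht p, ?_⟩
      rw [Nat.add_zero, arcs_self, mul_one, one_mul]
    | succ d ih =>
      intro hd
      obtain ⟨m, k, h1, h2, h3, h4, h5, h6, h7⟩ := ih (by omega)
      have hs : arcs n t (p + 1) (p + 1 + (d + 1)) =
          arcs n t (p + 1) (p + 1 + d) * arc n (p + 1 + d) (t (p + 1 + d)) := by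
        rw [← Nat.add_assoc (p + 1) d 1, ← arcs_succ, arcs_mul (by omega) (by omega)]
      rcases eq_or_lt_of_le h1 with h8 | h8
      · have h9 : Rel t m q := h6.symm.trans h
        have h10 := h9.apply_le (by omega)
        refine ⟨t m, m, by omega, by omega, by omega, by omega, rfl, h6.trans (ht m), ?_⟩
        rw [hs, ← mul_assoc, h7, h8, arc, if_pos h10.1, mul_assoc, mul_assoc,
          a_triangle' hp (by omega) h10.1 (by omega)]
      · refine ⟨m, k, by omega, h2, h3, by omega, h5, h6, ?_⟩
        rw [hs, ← mul_assoc, h7, mul_assoc, mul_assoc]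
        congr 1
        rw [arc]
        split_ifs with h9
        · have h10 := ht (p + 1 + d) k
          rw [h5] at h10
          have h11 : t (p + 1 + d) < m := by unfold Gap at h10; omega
          exact (a_commute_of_nested hp (by omega) h9 h11 (by omega)).eq
        · rw [one_mul, mul_one]
  obtain ⟨m, k, h1, h2, h3, h4, h5, h6, h7⟩ := key (q - (p + 1)) (by omega)
  have h8 : p + 1 + (q - (p + 1)) = q := by omega
  rw [h8] at h7 h1
  rwa [le_antisymm h2 h1] at h7

end

theorem braid_mul_a {n : ℕ} {s t : NC} {p q : ℕ} (htn : Supp n t.1) (h : Rel t.1 p q)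
    (hp : 1 ≤ p) (hpq : p < q) (hq : q ≤ n) (hs : s.1 = t.1 * swap p q) :
    braid n t = braid n s * a n p q := by
  have ht := t.2.1
  have hsp : s.1 p = t.1 q := by rw [hs, Perm.mul_apply, swap_apply_left]
  have hsq : s.1 q = t.1 p := by rw [hs, Perm.mul_apply, swap_apply_right]
  have hsi : ∀ i, i ≠ p → i ≠ q → s.1 i = t.1 i := fun i h1 h2 => by
    rw [hs, Perm.mul_apply, swap_apply_of_ne_of_ne h1 h2]
  have split : ∀ u : Perm ℕ, arcs n u 1 (n + 1) = arcs n u 1 p * (arc n p (u p) *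
      (arcs n u (p + 1) q * (arc n q (u q) * arcs n u (q + 1) (n + 1)))) := by
    intro u
    rw [← arcs_succ, ← arcs_succ, arcs_mul (by omega) (by omega), arcs_mul (by omega) (by omega),
      arcs_mul (by omega) (by omega), arcs_mul (by omega) (by omega)]
  have h1 := h.apply_le hpq
  rw [braid, braid, split, split, hsp, hsq, arcs_congr fun i h1 h2 => hsi i (by omega) (by omega),
    arcs_congr (l := p + 1) fun i h1 h2 => hsi i (by omega) (by omega),
    arcs_congr (l := q + 1) fun i h1 h2 => hsi i (by omega) (by omega)]
  have h2 : Commute (a n p q) (arcs n t.1 (q + 1) (n + 1)) := by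
    refine commute_arcs fun i hi hi' hti => a_commute_of_lt hp hpq (by omega) hti ?_
    exact (htn.apply_mem ⟨by omega, by omega⟩).2
  have h3 := arc_mul_arcs ht h hp hpq hq
  have h4 : arc n q (t.1 p) = 1 := if_neg (by omega)
  have h5 : arc n p (t.1 p) = a n p (t.1 p) := if_pos h1.1
  rw [h4, h5, one_mul, mul_assoc, mul_assoc, mul_assoc, ← h2.eq]
  congr 1
  rw [← mul_assoc, h3]
  rcases h.apply_gt_or_le with h6 | h6
  · have h7 : t.1 q ≤ n := (htn.apply_mem ⟨by omega, hq⟩).2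
    have h8 : Commute (a n p (t.1 q)) (arcs n t.1 (p + 1) q) := by
      refine commute_arcs fun i hi hi' hti => ?_
      have := h.apply_le_of_between (by omega) hi' hti
      exact a_commute_of_nested hp (by omega) hti (by omega) h7
    have e1 : arc n q (t.1 q) = a n q (t.1 q) := if_pos h6
    have e2 : arc n p (t.1 q) = a n p (t.1 q) := if_pos (by omega)
    rw [e1, e2, ← mul_assoc (a n p (t.1 q)), h8.eq, mul_assoc, mul_assoc,
      ← mul_assoc (a n p (t.1 q)), a_triangle hp hpq h6 h7, mul_assoc]
  · have e1 : arc n q (t.1 q) = 1 := if_neg (by omega)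
    have e2 : arc n p (t.1 q) = 1 := if_neg (by omega)
    rw [e1, e2, one_mul, one_mul, mul_assoc]

theorem NC.induction {n : ℕ} {P : NC → Prop} (h1 : P 1)
    (h : ∀ s : NC, Supp n s.1 → ∀ p q, 1 ≤ p → p < q → q ≤ n → ∀ hs : swapNC p q ≤ s,
      P (NC.div s (swapNC p q) hs) → P s) : ∀ s : NC, Supp n s.1 → P s := by
  suffices H : ∀ k, ∀ s : NC, Supp n s.1 → ((Finset.Icc 1 n).filter fun i => s.1 i ≠ i).card ≤ k →
      P s from fun s hs => H _ s hs le_rfl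
  intro k
  induction k with
  | zero =>
    intro s hs hk
    have hs1 : s = 1 := by
      apply Subtype.ext
      ext i
      by_contra hi
      have hi' : 1 ≤ i ∧ i ≤ n := by
        by_contra hi'
        exact hi (hs i hi')
      have h2 : i ∈ (Finset.Icc 1 n).filter fun i => s.1 i ≠ i := by
        simpa using ⟨hi', hi⟩
      rw [Finset.card_eq_zero.1 (Nat.le_zero.1 hk)] at h2
      cases h2
    rw [hs1]; exact h1
  | succ k ih =>
    intro s hs hk
    by_cases hs1 : ∀ i, s.1 i ≤ i
    · have hs2 : s = 1 := by
        apply Subtype.ext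
        ext i
        change s.1 i = i
        induction i using Nat.strong_induction_on with
        | _ i ihi =>
          rcases eq_or_lt_of_le (hs1 i) with h2 | h2
          · exact h2
          · exact absurd (s.1.injective (ihi _ h2)) (by omega)
      rw [hs2]; exact h1
    · push Not at hs1
      obtain ⟨p, hp⟩ := hs1
      have hp1 : 1 ≤ p ∧ p ≤ n := by
        by_contra hp'
        have := hs p hp'
        omega
      have hq := hs.apply_mem hp1
      have hle : swapNC p (s.1 p) ≤ s := (swapNC_le hp1.1 hq.1).2 (s.2.1 p)
      refine h s hs p (s.1 p) hp1.1 hp hq.2 hle (ih _ ?_ ?_)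
      · exact hs.mul (supp_swapNC hp1.1 hq.1 hp1.2 hq.2).inv
      · have hval : ∀ i, (NC.div s (swapNC p (s.1 p)) hle).1 i = s.1 (swap p (s.1 p) i) := by
          intro i
          simp [NC.div, swapNC_val hp1.1 hq.1]
        have hlt : ((Finset.Icc 1 n).filter fun i =>
            (NC.div s (swapNC p (s.1 p)) hle).1 i ≠ i) ⊂
            (Finset.Icc 1 n).filter fun i => s.1 i ≠ i := by
          rw [Finset.ssubset_iff_of_subset]
          · refine ⟨s.1 p, ?_, ?_⟩
            · have : s.1 p ≠ p := by omega
              simpa using ⟨hq, this⟩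
            · rw [Finset.mem_filter, hval, swap_apply_right]
              simp
          · intro i hi
            rw [Finset.mem_filter] at hi ⊢
            refine ⟨hi.1, fun hi' => hi.2 ?_⟩
            rw [hval, swap_apply_of_ne_of_ne, hi']
            · rintro rfl; omega
            · rintro rfl
              have := s.1.injective hi'
              omega
        have := Finset.card_lt_card hlt
        omega

theorem braid_one (n : ℕ) : braid n 1 = 1 := by
  apply List.prod_eq_one
  intro x hx
  obtain ⟨i, -, rfl⟩ := List.mem_map.1 hx
  exact if_neg (lt_irrefl i)

theorem braid_div_swap {n : ℕ} {t : NC} {p q : ℕ} (htn : Supp n t.1)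
    (hp : 1 ≤ p) (hpq : p < q) (hq : q ≤ n) (h : swapNC p q ≤ t) :
    braid n t = braid n (NC.div t (swapNC p q) h) * a n p q :=
  braid_mul_a htn ((swapNC_le hp (by omega)).1 h) hp hpq hq
    (by simp [NC.div, swapNC_val hp (show 1 ≤ q by omega)])

theorem braid_mul_braid {n : ℕ} (s : NC) (hs : Supp n s.1) : ∀ t : NC, Supp n t.1 → ∀ h : s ≤ t,
    braid n (NC.div t s h) * braid n s = braid n t := by
  refine NC.induction (n := n) (P := fun s => ∀ t : NC, Supp n t.1 → ∀ h : s ≤ t,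
    braid n (NC.div t s h) * braid n s = braid n t) ?_ ?_ s hs
  · intro t _ h
    rw [braid_one, mul_one]
    congr 1
  · intro s hs p q hp hpq hq hle ih t ht h
    have h' := hle.trans h
    have hsw : Supp n (swapNC p q).1 := supp_swapNC hp (by omega) (by omega) hq
    have h1 := ih (NC.div t (swapNC p q) h') (ht.mul hsw.inv) (NC.div_le_div hle h)
    rw [braid_div_swap hs hp hpq hq hle, braid_div_swap ht hp hpq hq h', ← h1, mul_assoc]
    congr 2
    apply Subtype.ext
    simp [NC.div]

/-- The braid represented by a word. -/
def ev (n : ℕ) : List NC → B n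
  | [] => 1
  | s :: u => ev n u * braid n s

theorem ev_append (n : ℕ) (u v : List NC) : ev n (u ++ v) = ev n v * ev n u := by
  induction u with
  | nil => simp [ev]
  | cons s u ih => simp [ev, ih, mul_assoc]

theorem ev_ones (n : ℕ) {u : List NC} (h : Ones u) : ev n u = 1 := by
  induction u with
  | nil => rfl
  | cons s u ih =>
    rw [ones_cons] at h
    rw [ev, ih h.2, h.1, braid_one, mul_one]

theorem braid_res {n : ℕ} {s t : NC} (hs : Supp n s.1) (ht : Supp n t.1) :
    braid n (res s t) * braid n s = braid n (res t s) * braid n t := by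
  have h1 := braid_mul_braid s hs (s ⊔ t) (NC.supp_sup hs ht) le_sup_left
  have h2 := braid_mul_braid t ht (t ⊔ s) (NC.supp_sup ht hs) le_sup_left
  rw [NC.res_eq, NC.res_eq, h1, h2, sup_comm]

theorem ev_lres {n : ℕ} {s : NC} {u : List NC} (hs : Supp n s.1) (hu : W n u) :
    ev n (lres s u) * braid n s = braid n (resl s u) * ev n u := by
  induction u generalizing s with
  | nil => simp [lres, resl, ev]
  | cons t u ih =>
    rw [w_cons] at hu
    rw [lres, ev, mul_assoc, braid_res hs hu.1, ← mul_assoc, ih (NC.supp_res hu.1 hs) hu.2, resl,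
      ev, mul_assoc]

theorem ev_wres {n : ℕ} {u v : List NC} (hu : W n u) (hv : W n v) :
    ev n (wres u v) * ev n u = ev n (wres v u) * ev n v := by
  induction u generalizing v with
  | nil => simp [wres_nil, wres, ev]
  | cons s u ih =>
    rw [w_cons] at hu
    rw [wres_cons, wres_cons_right, ev, ev, ← mul_assoc, ih hu.2 (hv.lres hu.1), mul_assoc,
      ev_lres hu.1 hv, mul_assoc]

theorem ev_eq_of_equiv {n : ℕ} {u v : List NC} (hu : W n u) (hv : W n v) (h : WEquiv u v) :
    ev n u = ev n v := by
  have h1 := ev_wres hu hv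
  rwa [ev_ones n h.1, ev_ones n h.2, one_mul, one_mul] at h1

theorem toF_braid {n : ℕ} (s : NC) (hs : Supp n s.1) : toF n (braid n s) = toFrac (gen s) := by
  refine NC.induction (n := n) (P := fun s => toF n (braid n s) = toFrac (gen s)) ?_ ?_ s hs
  · rw [braid_one, gen_one, map_one, map_one]
  · intro s hs p q hp hpq hq hle ih
    rw [braid_div_swap hs hp hpq hq hle, map_mul, ih, toF_a hp hpq hq, ← map_mul]
    congr 1
    exact gen_mul_gen hle (inv_mul_cancel_right _ _)

theorem toF_ev {n : ℕ} {u : List NC} (hu : W n u) : toF n (ev n u) = toFrac (mkW u) := by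
  induction u with
  | nil => rw [ev, mkW_nil, map_one, map_one]
  | cons s u ih =>
    rw [w_cons] at hu
    rw [ev, map_mul, ih hu.2, toF_braid s hu.1, mkW_cons, map_mul]

theorem ev_eq_iff {n : ℕ} {u v : List NC} (hu : W n u) (hv : W n v) :
    ev n u = ev n v ↔ WEquiv u v := by
  refine ⟨fun h => ?_, ev_eq_of_equiv hu hv⟩
  have h1 := congrArg (toF n) h
  rw [toF_ev hu, toF_ev hv] at h1
  exact mkW_eq.1 (toFrac_injective h1)

theorem braid_swapNC {n p q : ℕ} (hp : 1 ≤ p) (hpq : p < q) (hq : q ≤ n) :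
    braid n (swapNC p q) = a n p q := by
  have h := braid_div_swap (n := n) (supp_swapNC hp (by omega) (by omega) hq) hp hpq hq le_rfl
  rw [h]
  have : NC.div (swapNC p q) (swapNC p q) le_rfl = 1 := by
    apply Subtype.ext
    simp [NC.div, NC.one_val]
  rw [this, braid_one, one_mul]

theorem a_mem_BKL {n p q : ℕ} (hp : 1 ≤ p) (hpq : p < q) (hq : q ≤ n) : a n p q ∈ BKL n :=
  Submonoid.subset_closure ⟨p, q, hp, hpq, hq, rfl⟩

theorem braid_mem_BKL {n : ℕ} (s : NC) (hs : Supp n s.1) : braid n s ∈ BKL n := by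
  refine NC.induction (n := n) (P := fun s => braid n s ∈ BKL n) ?_ ?_ s hs
  · rw [braid_one]; exact one_mem _
  · intro s hs p q hp hpq hq hle ih
    rw [braid_div_swap hs hp hpq hq hle]
    exact mul_mem ih (a_mem_BKL hp hpq hq)

theorem ev_mem_BKL {n : ℕ} {u : List NC} (hu : W n u) : ev n u ∈ BKL n := by
  induction u with
  | nil => exact one_mem _
  | cons s u ih =>
    rw [w_cons] at hu
    exact mul_mem (ih hu.2) (braid_mem_BKL s hu.1)

theorem exists_ev_eq {n : ℕ} {x : B n} (hx : x ∈ BKL n) : ∃ u, W n u ∧ ev n u = x := by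
  induction hx using Submonoid.closure_induction with
  | mem x hx =>
    obtain ⟨p, q, hp, hpq, hq, rfl⟩ := hx
    refine ⟨[swapNC p q], w_cons.2 ⟨supp_swapNC hp (by omega) (by omega) hq, W.nil n⟩, ?_⟩
    rw [ev, ev, one_mul, braid_swapNC hp hpq hq]
  | one => exact ⟨[], W.nil n, rfl⟩
  | mul x y _ _ hx hy =>
    obtain ⟨u, hu, rfl⟩ := hx
    obtain ⟨v, hv, rfl⟩ := hy
    exact ⟨v ++ u, w_append.2 ⟨hv, hu⟩, ev_append n v u⟩

theorem rightDvd_ev_iff {n : ℕ} {u v : List NC} (hu : W n u) (hv : W n v) :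
    RightDvd n (ev n u) (ev n v) ↔ WDvd u v := by
  constructor
  · rintro ⟨z, hz, h⟩
    obtain ⟨w, hw, rfl⟩ := exists_ev_eq hz
    rw [← ev_append, ev_eq_iff hv (w_append.2 ⟨hu, hw⟩)] at h
    exact (wdvd_append u w).trans h.2
  · intro h
    refine ⟨ev n (wres u v), ev_mem_BKL (hu.wres hv), ?_⟩
    rw [← ev_append]
    exact ev_eq_of_equiv hv (w_append.2 ⟨hu, hu.wres hv⟩) h.equiv_append

end DualBraid

namespace DualBraid

open Equiv Complemented

theorem incl_σ {n i : ℕ} (hi : 1 ≤ i) (hn : i < n - 1) : incl n (σ (n - 1) i) = σ n i := by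
  rw [σ_eq ⟨hi, hn⟩, σ_eq ⟨hi, by omega⟩]
  exact PresentedGroup.toGroup.of (incl_rels n)

theorem incl_a {n p q : ℕ} (hp : 1 ≤ p) (hpq : p < q) (hq : q ≤ n - 1) :
    incl n (a (n - 1) p q) = a n p q := by
  obtain ⟨d, rfl⟩ : ∃ d, q = p + 1 + d := ⟨q - (p + 1), by omega⟩
  induction d generalizing p with
  | zero => rw [Nat.add_zero, a_self_succ, a_self_succ, incl_σ hp (by omega)]
  | succ d ih =>
    have h1 := ih (p := p + 1) (by omega) (by omega) (by omega)
    rw [show p + 1 + 1 + d = p + 1 + (d + 1) by omega] at h1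
    rw [a_eq_conj (by omega), map_mul, map_mul, map_inv, h1, incl_σ hp (by omega),
      ← a_eq_conj (by omega)]

theorem incl_braid {n : ℕ} (s : NC) (hs : Supp (n - 1) s.1) :
    incl n (braid (n - 1) s) = braid n s := by
  refine NC.induction (n := n - 1) (P := fun s => incl n (braid (n - 1) s) = braid n s) ?_ ?_ s hs
  · rw [braid_one, braid_one, map_one]
  · intro s hs p q hp hpq hq hle ih
    rw [braid_div_swap hs hp hpq hq hle,
      braid_div_swap (hs.mono (Nat.sub_le n 1)) hp hpq (hq.trans (Nat.sub_le n 1)) hle, map_mul, ih,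
      incl_a hp hpq hq]

theorem incl_ev {n : ℕ} {u : List NC} (hu : W (n - 1) u) : incl n (ev (n - 1) u) = ev n u := by
  induction u with
  | nil => exact map_one _
  | cons s u ih =>
    rw [w_cons] at hu
    rw [ev, map_mul, ih hu.2, incl_braid s hu.1, ev]

theorem incl_mem {n : ℕ} {x : B (n - 1)} (hx : x ∈ BKL (n - 1)) : incl n x ∈ BKL n := by
  obtain ⟨u, hu, rfl⟩ := exists_ev_eq hx
  rw [incl_ev hu]
  exact ev_mem_BKL (hu.mono (Nat.sub_le n 1))

theorem incl_inj {n : ℕ} {x y : B (n - 1)} (hx : x ∈ BKL (n - 1)) (hy : y ∈ BKL (n - 1))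
    (h : incl n x = incl n y) : x = y := by
  obtain ⟨u, hu, rfl⟩ := exists_ev_eq hx
  obtain ⟨v, hv, rfl⟩ := exists_ev_eq hy
  rw [incl_ev hu, incl_ev hv, ev_eq_iff (hu.mono (Nat.sub_le n 1)) (hv.mono (Nat.sub_le n 1))] at h
  exact (ev_eq_iff hu hv).2 h

theorem Δ_eq_braid (n : ℕ) : Δ n = braid n (cycNC n) := by
  rcases Nat.eq_zero_or_pos n with rfl | hn
  · rw [Δ, braid, arcs_self, List.Ico.eq_nil_of_le (by omega)]; rfl
  · have h1 : arc n n ((cycNC n).1 n) = 1 := by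
      refine if_neg ?_
      change ¬ n < cyc n n
      rw [cyc_apply]; grind
    rw [braid, ← arcs_mul (m := n) (by omega) (by omega), arcs_succ, h1, mul_one, Δ, arcs]
    congr 1
    refine List.map_congr_left fun i hi => ?_
    rw [List.Ico.mem] at hi
    have h2 : (cycNC n).1 i = i + 1 := if_pos hi
    rw [h2, arc, if_pos (Nat.lt_succ_self i)]

theorem Δ_mul_braid {n : ℕ} {s : NC} (hs : Supp n s.1) :
    Δ n * braid n s = braid n (rot n s) * Δ n := by
  have h1 : s ≤ cycNC n := hs.below_cyc
  have hd : Supp n (NC.div (cycNC n) s h1).1 := (cyc_supp n).mul hs.inv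
  have h2 := braid_mul_braid s hs (cycNC n) (cyc_supp n) h1
  have h3 := braid_mul_braid _ hd (cycNC n) (cyc_supp n) hd.below_cyc
  have h4 : NC.div (cycNC n) (NC.div (cycNC n) s h1) hd.below_cyc = rot n s := by
    apply Subtype.ext
    rw [rot_val hs]
    simp [NC.div, cycNC, mul_assoc]
  rw [h4] at h3
  rw [Δ_eq_braid]
  conv_rhs => rw [← h2, ← mul_assoc, h3]

theorem φ_apply (n : ℕ) (x : B n) : φ n x = Δ n * x * (Δ n)⁻¹ := rfl

theorem φ_braid {n : ℕ} {s : NC} (hs : Supp n s.1) : φ n (braid n s) = braid n (rot n s) := by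
  rw [φ_apply, Δ_mul_braid hs, mul_inv_cancel_right]

theorem φ_ev {n : ℕ} {u : List NC} (hu : W n u) : φ n (ev n u) = ev n (u.map (rot n)) := by
  induction u with
  | nil => exact map_one _
  | cons s u ih =>
    rw [w_cons] at hu
    rw [ev, map_mul, ih hu.2, φ_braid hu.1]; rfl

theorem φ_mem {n : ℕ} {x : B n} (hx : x ∈ BKL n) : φ n x ∈ BKL n := by
  obtain ⟨u, hu, rfl⟩ := exists_ev_eq hx
  rw [φ_ev hu]; exact ev_mem_BKL hu.rot

theorem exists_map_rot_eq {n : ℕ} {u : List NC} (hu : W n u) : ∃ v, W n v ∧ v.map (rot n) = u := by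
  induction u with
  | nil => exact ⟨[], W.nil n, rfl⟩
  | cons s u ih =>
    rw [w_cons] at hu
    obtain ⟨v, hv, h⟩ := ih hu.2
    obtain ⟨r, hr, h', -⟩ := exists_rot_eq hu.1
    exact ⟨r :: v, w_cons.2 ⟨hr, hv⟩, by rw [List.map_cons, h, h']⟩

theorem exists_φ_eq {n : ℕ} {x : B n} (hx : x ∈ BKL n) : ∃ y ∈ BKL n, φ n y = x := by
  obtain ⟨u, hu, rfl⟩ := exists_ev_eq hx
  obtain ⟨v, hv, rfl⟩ := exists_map_rot_eq hu
  exact ⟨ev n v, ev_mem_BKL hv, φ_ev hv⟩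

theorem rot_swapNC {n p q : ℕ} (hp : 1 ≤ p ∧ p ≤ n) (hq : 1 ≤ q ∧ q ≤ n) :
    rot n (swapNC p q) = swapNC (cyc n p) (cyc n q) := by
  have h1 := (cyc_supp n).apply_mem hp
  have h2 := (cyc_supp n).apply_mem hq
  apply Subtype.ext
  rw [rot_val (supp_swapNC hp.1 hq.1 hp.2 hq.2), swapNC_val hp.1 hq.1, swapNC_val h1.1 h2.1,
    Equiv.swap_apply_apply]

theorem swapNC_comm (p q : ℕ) : swapNC p q = swapNC q p := by
  unfold swapNC
  split_ifs with h1 h2 h2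
  · exact Subtype.ext (swap_comm p q)
  · exact absurd ⟨h1.2, h1.1⟩ h2
  · exact absurd ⟨h2.2, h2.1⟩ h1
  · rfl

theorem φ_a_of_lt {n p q : ℕ} (hp : 1 ≤ p) (hpq : p < q) (hq : q < n) :
    φ n (a n p q) = a n (p + 1) (q + 1) := by
  have h1 : cyc n p = p + 1 := if_pos ⟨hp, by omega⟩
  have h2 : cyc n q = q + 1 := if_pos ⟨by omega, by omega⟩
  rw [← braid_swapNC hp hpq hq.le, φ_braid (supp_swapNC hp (by omega) (by omega) (by omega)),
    rot_swapNC ⟨hp, by omega⟩ ⟨by omega, by omega⟩, h1, h2,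
    braid_swapNC (by omega) (by omega) (by omega)]

theorem φ_a_last {n p : ℕ} (hp : 1 ≤ p) (hpn : p < n) : φ n (a n p n) = a n 1 (p + 1) := by
  have h1 : cyc n p = p + 1 := if_pos ⟨hp, by omega⟩
  have h2 : cyc n n = 1 := by rw [cyc_apply]; grind
  rw [← braid_swapNC hp hpn le_rfl, φ_braid (supp_swapNC hp (by omega) (by omega) (by omega)),
    rot_swapNC ⟨hp, by omega⟩ ⟨by omega, by omega⟩, h1, h2, swapNC_comm,
    braid_swapNC (by omega) (by omega) (by omega)]

theorem len_rels (n : ℕ) : ∀ r ∈ artinRels n,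
    FreeGroup.lift (fun _ : Idx n => Multiplicative.ofAdd (1 : ℤ)) r = 1 := by
  rintro r (⟨i, j, -, rfl⟩ | ⟨i, j, -, rfl⟩) <;>
    simp only [map_mul, map_inv, FreeGroup.lift_apply_of, mul_inv_cancel]

/-- The length homomorphism, which maps each `σᵢ` to `1`. -/
def lenHom (n : ℕ) : B n →* Multiplicative ℤ := PresentedGroup.toGroup (len_rels n)

/-- The length of a braid. -/
def len (n : ℕ) (x : B n) : ℤ := Multiplicative.toAdd (lenHom n x)

theorem len_mul {n : ℕ} (x y : B n) : len n (x * y) = len n x + len n y := by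
  rw [len, map_mul]; rfl

theorem len_one (n : ℕ) : len n 1 = 0 := by
  rw [len, map_one]; rfl

theorem len_conj {n : ℕ} (x y : B n) : len n (x * y * x⁻¹) = len n y := by
  rw [len, map_mul (lenHom n), map_mul (lenHom n), map_inv, mul_inv_cancel_comm, len]

theorem len_φ {n : ℕ} (x : B n) : len n (φ n x) = len n x := len_conj _ _

theorem len_a {n p q : ℕ} (hp : 1 ≤ p) (hpq : p < q) (hq : q ≤ n) : len n (a n p q) = 1 := by
  rw [a, len_conj, σ_eq ⟨by omega, by omega⟩, len]
  exact congrArg Multiplicative.toAdd (PresentedGroup.toGroup.of (len_rels n))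

theorem BKL.exists_mul_a {n : ℕ} {x : B n} (hx : x ∈ BKL n) :
    x = 1 ∨ ∃ p q, 1 ≤ p ∧ p < q ∧ q ≤ n ∧ ∃ z ∈ BKL n, x = z * a n p q := by
  induction hx using Submonoid.closure_induction with
  | mem x hx =>
    obtain ⟨p, q, hp, hpq, hq, rfl⟩ := hx
    exact Or.inr ⟨p, q, hp, hpq, hq, 1, one_mem _, (one_mul _).symm⟩
  | one => exact Or.inl rfl
  | mul x y hx _ hx' hy' =>
    rcases hy' with rfl | ⟨p, q, hp, hpq, hq, z, hz, rfl⟩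
    · rwa [mul_one]
    · exact Or.inr ⟨p, q, hp, hpq, hq, x * z, mul_mem hx hz, (mul_assoc _ _ _).symm⟩

theorem len_nonneg {n : ℕ} {x : B n} (hx : x ∈ BKL n) : 0 ≤ len n x := by
  induction hx using Submonoid.closure_induction with
  | mem x hx =>
    obtain ⟨p, q, hp, hpq, hq, rfl⟩ := hx
    rw [len_a hp hpq hq]; exact zero_le_one
  | one => rw [len_one]
  | mul x y _ _ hx hy => rw [len_mul]; omega

theorem eq_one_of_len {n : ℕ} {x : B n} (hx : x ∈ BKL n) (h : len n x ≤ 0) : x = 1 := by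
  rcases BKL.exists_mul_a hx with h1 | ⟨p, q, hp, hpq, hq, z, hz, rfl⟩
  · exact h1
  · rw [len_mul, len_a hp hpq hq] at h
    have := len_nonneg hz
    omega

namespace RightDvd

variable {n : ℕ} {x y z : B n}

theorem refl (x : B n) : RightDvd n x x := ⟨1, one_mem _, (one_mul x).symm⟩

theorem mul_left (hz : z ∈ BKL n) (x : B n) : RightDvd n x (z * x) := ⟨z, hz, rfl⟩

theorem trans (h : RightDvd n x y) (h' : RightDvd n y z) : RightDvd n x z := by
  obtain ⟨u, hu, rfl⟩ := h
  obtain ⟨v, hv, rfl⟩ := h'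
  exact ⟨v * u, mul_mem hv hu, (mul_assoc _ _ _).symm⟩

theorem len_le (h : RightDvd n x y) : len n x ≤ len n y := by
  obtain ⟨u, hu, rfl⟩ := h
  rw [len_mul]
  have := len_nonneg hu
  omega

theorem eq_of_len_le (h : RightDvd n x y) (h' : len n y ≤ len n x) : x = y := by
  obtain ⟨u, hu, rfl⟩ := h
  rw [len_mul] at h'
  rw [eq_one_of_len hu (by omega), one_mul]

theorem antisymm (h : RightDvd n x y) (h' : RightDvd n y x) : x = y := h.eq_of_len_le h'.len_le

theorem map_incl {x y : B (n - 1)} (h : RightDvd (n - 1) x y) :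
    RightDvd n (incl n x) (incl n y) := by
  obtain ⟨u, hu, rfl⟩ := h
  exact ⟨incl n u, incl_mem hu, map_mul _ _ _⟩

end RightDvd

theorem one_rightDvd {n : ℕ} {x : B n} (hx : x ∈ BKL n) : RightDvd n 1 x :=
  ⟨x, hx, (mul_one x).symm⟩

theorem exists_lcm {n : ℕ} {x y : B (n - 1)} (hx : x ∈ BKL (n - 1)) (hy : y ∈ BKL (n - 1)) :
    ∃ z ∈ BKL (n - 1), RightDvd (n - 1) x z ∧ RightDvd (n - 1) y z ∧
      ∀ w ∈ BKL n, RightDvd n (incl n x) w → RightDvd n (incl n y) w → RightDvd n (incl n z) w := by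
  obtain ⟨u, hu, rfl⟩ := exists_ev_eq hx
  obtain ⟨v, hv, rfl⟩ := exists_ev_eq hy
  have hw : W (n - 1) (u ++ wres u v) := w_append.2 ⟨hu, hu.wres hv⟩
  have hn := Nat.sub_le n 1
  refine ⟨ev (n - 1) (u ++ wres u v), ev_mem_BKL hw, (rightDvd_ev_iff hu hw).2 (wdvd_append _ _),
    (rightDvd_ev_iff hv hw).2 (wdvd_append_wres _ _), ?_⟩
  intro w hw' h1 h2
  obtain ⟨t, ht, rfl⟩ := exists_ev_eq hw'
  rw [incl_ev hu, rightDvd_ev_iff (hu.mono hn) ht] at h1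
  rw [incl_ev hv, rightDvd_ev_iff (hv.mono hn) ht] at h2
  rw [incl_ev hw, rightDvd_ev_iff (hw.mono hn) ht]
  exact append_wres_wdvd h1 h2

theorem len_incl {n : ℕ} {x : B (n - 1)} (hx : x ∈ BKL (n - 1)) :
    len n (incl n x) = len (n - 1) x := by
  induction hx using Submonoid.closure_induction with
  | mem x hx =>
    obtain ⟨p, q, hp, hpq, hq, rfl⟩ := hx
    rw [incl_a hp hpq hq, len_a hp hpq hq, len_a hp hpq (by omega)]
  | one => rw [map_one, len_one, len_one]
  | mul x y _ _ hx hy => rw [map_mul, len_mul, len_mul, hx, hy]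

theorem exists_isTail {n : ℕ} {x : B n} (hx : x ∈ BKL n) : ∃ t, IsTail n x t := by
  by_contra hno
  have step : ∀ k : ℕ, ∃ t ∈ BKL (n - 1), RightDvd n (incl n t) x ∧ (k : ℤ) ≤ len (n - 1) t := by
    intro k
    induction k with
    | zero => exact ⟨1, one_mem _, by rw [map_one]; exact one_rightDvd hx, by rw [len_one]; rfl⟩
    | succ k ih =>
      obtain ⟨t, ht, h1, h2⟩ := ih
      by_contra hk
      refine hno ⟨t, ht, h1, fun u hu h3 => ?_⟩
      obtain ⟨z, hz, h4, h5, h6⟩ := exists_lcm ht hu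
      have h7 : ¬ ((k + 1 : ℕ) : ℤ) ≤ len (n - 1) z := fun h8 => hk ⟨z, hz, h6 x hx h1 h3, h8⟩
      have h8 : t = z := h4.eq_of_len_le (by push_cast at h7; omega)
      rw [h8]
      exact h5.map_incl
  obtain ⟨t, ht, h1, h2⟩ := step ((len n x).toNat + 1)
  have h3 := h1.len_le
  rw [len_incl ht] at h3
  push_cast at h2
  omega

theorem IsTail.unique {n : ℕ} {x : B n} {t t' : B (n - 1)} (h : IsTail n x t)
    (h' : IsTail n x t') : t = t' :=
  incl_inj h.1 h'.1 ((h'.2.2 t h.1 h.2.1).antisymm (h.2.2 t' h'.1 h'.2.1))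

theorem isTail_one_iff {n : ℕ} {x : B n} (hx : x ∈ BKL n) :
    IsTail n x 1 ↔ ∀ p q, 1 ≤ p → p < q → q < n → ¬ RightDvd n (a n p q) x := by
  constructor
  · intro h p q hp hpq hq hd
    have hq' : q ≤ n - 1 := by omega
    have h1 := h.2.2 (a (n - 1) p q) (a_mem_BKL hp hpq hq')
    rw [incl_a hp hpq hq', map_one] at h1
    have h2 := (h1 hd).len_le
    rw [len_a hp hpq hq.le, len_one] at h2
    omega
  · intro h
    refine ⟨one_mem _, by rw [map_one]; exact one_rightDvd hx, fun u hu hd => ?_⟩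
    rcases BKL.exists_mul_a hu with rfl | ⟨p, q, hp, hpq, hq, z, hz, rfl⟩
    · exact RightDvd.refl _
    · refine absurd (RightDvd.trans ?_ hd) (h p q hp hpq (by omega))
      rw [map_mul, incl_a hp hpq hq]
      exact RightDvd.mul_left (incl_mem hz) _

theorem isTail_mul_incl {n : ℕ} {x : B n} {t : B (n - 1)} (hx : x ∈ BKL n)
    (ht : t ∈ BKL (n - 1)) (h : IsTail n x 1) : IsTail n (x * incl n t) t := by
  refine ⟨ht, RightDvd.mul_left hx _, fun u hu hd => ?_⟩
  obtain ⟨z, hz, ⟨y, hy, rfl⟩, h2, h3⟩ := exists_lcm ht hu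
  obtain ⟨w, hw, h4⟩ := h3 _ (mul_mem hx (incl_mem ht)) (RightDvd.mul_left hx _) hd
  rw [map_mul, ← mul_assoc] at h4
  have h5 := h.2.2 y hy ⟨w, hw, mul_right_cancel h4⟩
  have h6 : incl n y = incl n 1 := h5.antisymm (by rw [map_one]; exact one_rightDvd (incl_mem hy))
  have h7 := h2.map_incl
  rwa [map_mul, h6, map_one, one_mul] at h7

theorem IsTail.exists_eq_mul {n : ℕ} {x : B n} {t : B (n - 1)} (h : IsTail n x t) :
    ∃ y ∈ BKL n, x = y * incl n t ∧ IsTail n y 1 := by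
  obtain ⟨ht, ⟨y, hy, rfl⟩, h2⟩ := h
  refine ⟨y, hy, rfl, one_mem _, by rw [map_one]; exact one_rightDvd hy, fun u hu ⟨w, hw, hd⟩ => ?_⟩
  have h3 := (h2 (u * t) (mul_mem hu ht) ⟨w, hw, by rw [map_mul, ← mul_assoc, ← hd]⟩).len_le
  rw [map_mul, len_mul] at h3
  have h4 : incl n u = 1 := eq_one_of_len (incl_mem hu) (by omega)
  rw [h4, map_one]
  exact RightDvd.refl _

theorem rightDvd_a_ev_iff {n p q : ℕ} (hp : 1 ≤ p) (hpq : p < q) (hq : q ≤ n) {u : List NC}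
    (hu : W n u) : RightDvd n (a n p q) (ev n u) ↔ WDvd [swapNC p q] u := by
  have h : W n [swapNC p q] := w_cons.2 ⟨supp_swapNC hp (by omega) (by omega) hq, W.nil n⟩
  rw [← rightDvd_ev_iff h hu, ev, ev, one_mul, braid_swapNC hp hpq hq]

theorem supp_of_wdvd {n : ℕ} {s : NC} {u : List NC} (hu : W n u) (h : WDvd [s] u) :
    Supp n s.1 := by
  induction u generalizing s with
  | nil =>
    have h1 : s = 1 := h s (List.mem_singleton_self s)
    rw [h1]; exact fun _ _ => rfl
  | cons t u ih =>
    rw [w_cons] at hu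
    have h1 : Supp n (res t s).1 := ih hu.2 h
    have h2 : Supp n (t ⊔ s).1 := by
      have := h1.mul hu.1
      rwa [NC.res_val, inv_mul_cancel_right] at this
    exact Below.supp (le_sup_right : s ≤ t ⊔ s) h2

theorem not_rightDvd_incl {n p : ℕ} (hp : 1 ≤ p) (hpn : p < n) {x : B (n - 1)}
    (hx : x ∈ BKL (n - 1)) : ¬ RightDvd n (a n p n) (incl n x) := by
  obtain ⟨u, hu, rfl⟩ := exists_ev_eq hx
  rw [incl_ev hu, rightDvd_a_ev_iff hp hpn le_rfl (hu.mono (Nat.sub_le n 1))]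
  intro h
  have h1 := supp_of_wdvd hu h n (by omega)
  rw [swapNC_val hp (by omega), swap_apply_right] at h1
  omega

end DualBraid

namespace DualBraid

open Equiv Complemented

theorem φ_pow_succ_apply (n k : ℕ) (x : B n) : (φ n ^ (k + 1)) x = φ n ((φ n ^ k) x) := by
  rw [pow_succ']; rfl

theorem splitProd_concat (n : ℕ) (s : List (B (n - 1))) (t : B (n - 1)) :
    splitProd n (s ++ [t]) = φ n (splitProd n s) * incl n t := by
  induction s with
  | nil => simp [splitProd]
  | cons b s ih =>
    rw [List.cons_append, splitProd, ih, splitProd, map_mul, List.length_append,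
      List.length_singleton, φ_pow_succ_apply, mul_assoc]

theorem splitProd_singleton (n : ℕ) (t : B (n - 1)) : splitProd n [t] = incl n t := by
  simp [splitProd]

theorem splitProd_mem {n : ℕ} {s : List (B (n - 1))} (h : ∀ b ∈ s, b ∈ BKL (n - 1)) :
    splitProd n s ∈ BKL n := by
  induction s using List.reverseRecOn with
  | nil => exact one_mem _
  | append_singleton s t ih =>
    rw [splitProd_concat]
    exact mul_mem (φ_mem (ih fun b hb => h b (by simp [hb]))) (incl_mem (h t (by simp)))

theorem isTail_one_one (n : ℕ) : IsTail n 1 1 := by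
  rw [isTail_one_iff (one_mem _)]
  intro p q hp hpq hq hd
  have := hd.len_le
  rw [len_a hp hpq hq.le, len_one] at this
  omega

theorem isSplitting_singleton {n : ℕ} {β : B n} {t : B (n - 1)} :
    IsSplitting n β [t] ↔ t ∈ BKL (n - 1) ∧ β = incl n t := by
  constructor
  · rintro ⟨-, -, h1, -, h2, -⟩
    exact ⟨h1 t (by simp), by rw [h2, splitProd_singleton]⟩
  · rintro ⟨ht, rfl⟩
    refine ⟨incl_mem ht, by simp, by simpa using ht, by simp, (splitProd_singleton n t).symm, ?_⟩
    intro k h1 h2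
    obtain rfl : k = 1 := le_antisymm h2 h1
    simpa [splitProd] using isTail_one_one n

theorem isSplitting_concat {n : ℕ} {β : B n} {s : List (B (n - 1))} {t : B (n - 1)}
    (hs : s ≠ []) : IsSplitting n β (s ++ [t]) ↔ IsSplitting n (splitProd n s) s ∧
      s.head? ≠ some 1 ∧ t ∈ BKL (n - 1) ∧ β = φ n (splitProd n s) * incl n t ∧
      IsTail n (φ n (splitProd n s)) 1 := by
  have hlen : 1 ≤ s.length := List.length_pos_iff.2 hs
  have hhead : (s ++ [t]).head? = s.head? := List.head?_append_of_ne_nil s hs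
  have htake : ∀ k, 1 ≤ k → (s ++ [t]).take ((s ++ [t]).length - k) = s.take (s.length - (k - 1)) := by
    intro k hk
    rw [List.length_append, List.length_singleton, List.take_append_of_le_length (by omega)]
    congr 1
    omega
  constructor
  · rintro ⟨h1, -, h3, h4, h5, h6⟩
    have h7 : ∀ b ∈ s, b ∈ BKL (n - 1) := fun b hb => h3 b (by simp [hb])
    have h8 : s.head? ≠ some 1 := by
      rw [← hhead]; exact h4 (by simp; omega)
    refine ⟨⟨splitProd_mem h7, hs, h7, fun _ => h8, rfl, fun k hk hk' => ?_⟩, h8, h3 t (by simp),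
      by rw [h5, splitProd_concat], ?_⟩
    · have := h6 (k + 1) (by omega) (by simp; omega)
      rwa [htake _ (by omega), Nat.add_sub_cancel] at this
    · have := h6 1 le_rfl (by simp)
      rwa [htake _ le_rfl, Nat.sub_self, Nat.sub_zero, List.take_length] at this
  · rintro ⟨⟨h1, -, h3, -, -, h6⟩, h8, h9, rfl, h10⟩
    refine ⟨mul_mem (φ_mem h1) (incl_mem h9), by simp, ?_, fun _ => by rwa [hhead],
      (splitProd_concat n s t).symm, fun k hk hk' => ?_⟩
    · intro b hb
      rcases List.mem_append.1 hb with hb | hb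
      · exact h3 b hb
      · rw [List.mem_singleton.1 hb]; exact h9
    · rw [htake k hk]
      rcases eq_or_lt_of_le hk with rfl | hk
      · rwa [Nat.sub_self, Nat.sub_zero, List.take_length]
      · refine h6 (k - 1) (by omega) ?_
        rw [List.length_append, List.length_singleton] at hk'
        omega

theorem splitProd_ne_one {n : ℕ} {s : List (B (n - 1))} (h : ∀ b ∈ s, b ∈ BKL (n - 1))
    (hs : s ≠ []) (hh : s.head? ≠ some 1) : splitProd n s ≠ 1 := by
  cases s with
  | nil => exact absurd rfl hs
  | cons b s =>
    intro h1
    apply hh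
    have h2 := congrArg (len n) h1
    have h3 : ∀ (k : ℕ) (x : B n), len n ((φ n ^ k) x) = len n x := by
      intro k x
      induction k with
      | zero => rfl
      | succ k ih => rw [φ_pow_succ_apply, len_φ, ih]
    have hb := h b (by simp)
    rw [splitProd, len_mul, h3, len_one, len_incl hb] at h2
    have h4 := len_nonneg (splitProd_mem (n := n) (s := s) fun c hc => h c (by simp [hc]))
    rw [eq_one_of_len hb (by omega)]
    rfl

theorem IsSplitting.last {n : ℕ} {β : B n} {s : List (B (n - 1))} {t : B (n - 1)}
    (h : IsSplitting n β (s ++ [t])) :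
    IsTail n β t ∧ β = φ n (splitProd n s) * incl n t ∧ (s ≠ [] → splitProd n s ≠ 1) := by
  have h1 := h.2.2.2.2.2 1 le_rfl (by simp)
  have h2 : β = φ n (splitProd n s) * incl n t := by rw [h.2.2.2.2.1, splitProd_concat]
  have h3 : ∀ b ∈ s, b ∈ BKL (n - 1) := fun b hb => h.2.2.1 b (by simp [hb])
  have h4 : (s ++ [t]).take ((s ++ [t]).length - 1) = s := by simp
  rw [h4] at h1
  refine ⟨?_, h2, fun hs => splitProd_ne_one h3 hs ((isSplitting_concat hs).1 h).2.1⟩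
  rw [h2]
  exact isTail_mul_incl (φ_mem (splitProd_mem h3)) (h.2.2.1 t (by simp)) h1

theorem IsSplitting.unique {n : ℕ} {β : B n} {s s' : List (B (n - 1))} (h : IsSplitting n β s)
    (h' : IsSplitting n β s') : s = s' := by
  induction s using List.reverseRecOn generalizing β s' with
  | nil => exact absurd rfl h.2.1
  | append_singleton s t ih =>
    rcases List.eq_nil_or_concat s' with rfl | ⟨s', t', rfl⟩
    · exact absurd rfl h'.2.1
    rw [List.concat_eq_append] at h' ⊢
    obtain ⟨h1, h2, h3⟩ := h.last
    obtain ⟨h1', h2', h3'⟩ := h'.last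
    obtain rfl := h1.unique h1'
    have h4 : splitProd n s = splitProd n s' :=
      (φ n).injective (mul_right_cancel (h2.symm.trans h2'))
    congr 1
    by_cases hs : s = []
    · by_cases hs' : s' = []
      · rw [hs, hs']
      · rw [hs] at h4
        exact absurd h4.symm (h3' hs')
    · by_cases hs' : s' = []
      · rw [hs'] at h4
        exact absurd h4 (h3 hs)
      · have h5 := ((isSplitting_concat hs').1 h').1
        rw [← h4] at h5
        exact ih ((isSplitting_concat hs).1 h).1 h5

theorem exists_isSplitting_mul {n : ℕ} {x : B n} {t : B (n - 1)} (ht : t ∈ BKL (n - 1))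
    (hx : x ≠ 1 → ∃ s, IsSplitting n x s) (h : IsTail n (φ n x) 1) :
    ∃ s, IsSplitting n (φ n x * incl n t) s := by
  by_cases hx1 : x = 1
  · exact ⟨[t], isSplitting_singleton.2 ⟨ht, by rw [hx1, map_one, one_mul]⟩⟩
  · obtain ⟨s, hs⟩ := hx hx1
    have hsx : x = splitProd n s := hs.2.2.2.2.1
    refine ⟨s ++ [t], (isSplitting_concat hs.2.1).2 ?_⟩
    rw [← hsx]
    refine ⟨hs, fun hh => ?_, ht, rfl, h⟩
    rcases s with _ | ⟨b, _ | ⟨c, s⟩⟩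
    · exact hs.2.1 rfl
    · have hb : b = 1 := by simpa using hh
      rw [hb, splitProd_singleton, map_one] at hsx
      exact hx1 hsx
    · exact hs.2.2.2.1 (by simp) hh

theorem exists_isSplitting {n : ℕ} (hn : 3 ≤ n) {x : B n} (hx : x ∈ BKL n) :
    ∃ s, IsSplitting n x s := by
  suffices H : ∀ L : ℕ, ∀ x ∈ BKL n, len n x ≤ L → ∃ s, IsSplitting n x s by
    exact H (len n x).toNat x hx (by omega)
  have h0 : ∀ x ∈ BKL n, len n x ≤ 0 → ∃ s, IsSplitting n x s := fun x hx hl =>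
    ⟨[1], isSplitting_singleton.2 ⟨one_mem _, by rw [eq_one_of_len hx hl, map_one]⟩⟩
  intro L
  induction L with
  | zero => exact h0
  | succ L ih =>
    have key : ∀ k : ℕ, ∀ y ∈ BKL n, len n y ≤ (L + 1 : ℕ) →
        (∃ p q, 1 ≤ p ∧ p < q ∧ q < n ∧ RightDvd n (a n p q) y) →
        ∃ s, IsSplitting n ((φ n ^ k) y) s := by
      intro k
      induction k with
      | zero =>
        rintro y hy hl ⟨p, q, hp, hpq, hq, hd⟩
        obtain ⟨t, ht⟩ := exists_isTail hy
        obtain ⟨z, hz, rfl, hz'⟩ := ht.exists_eq_mul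
        obtain ⟨x, hx, rfl⟩ := exists_φ_eq hz
        refine exists_isSplitting_mul ht.1 (fun _ => ih x hx ?_) hz'
        have h1 : ¬ len (n - 1) t ≤ 0 := by
          intro h1
          rw [eq_one_of_len ht.1 h1, map_one, mul_one] at hd
          exact (isTail_one_iff hz).1 hz' p q hp hpq hq hd
        rw [len_mul, len_φ, len_incl ht.1] at hl
        push_cast at hl
        omega
      | succ k ihk =>
        intro y hy hl hd
        have hmem : ∀ j, (φ n ^ j) y ∈ BKL n := by
          intro j
          induction j with
          | zero => exact hy
          | succ j ih => rw [φ_pow_succ_apply]; exact φ_mem ih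
        have hlen : ∀ j, len n ((φ n ^ j) y) = len n y := by
          intro j
          induction j with
          | zero => rfl
          | succ j ih => rw [φ_pow_succ_apply, len_φ, ih]
        have hm := hmem (k + 1)
        have hl' := hlen (k + 1)
        obtain ⟨t, ht⟩ := exists_isTail hm
        obtain ⟨z, hz, hyz, hz'⟩ := ht.exists_eq_mul
        obtain ⟨x, hx, rfl⟩ := exists_φ_eq hz
        rw [hyz]
        refine exists_isSplitting_mul ht.1 (fun _ => ?_) hz'
        by_cases h1 : len (n - 1) t ≤ 0
        · rw [eq_one_of_len ht.1 h1, map_one, mul_one, φ_pow_succ_apply] at hyz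
          rw [← (φ n).injective hyz]
          exact ihk y hy hl hd
        · refine ih x hx ?_
          rw [hyz, len_mul, len_φ, len_incl ht.1] at hl'
          push_cast at hl
          omega
    intro x hx hl
    rcases BKL.exists_mul_a hx with rfl | ⟨p, q, hp, hpq, hq, z, hz, rfl⟩
    · exact h0 1 hx (by rw [len_one])
    · rcases eq_or_lt_of_le hq with rfl | hq
      · obtain ⟨z, hz', rfl⟩ := exists_φ_eq hz
        rw [len_mul, len_φ, len_a hp hpq le_rfl] at hl
        by_cases hp1 : p = 1
        · obtain ⟨w, hw, rfl⟩ := exists_φ_eq hz'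
          have h1 : a q 1 q = φ q (φ q (a q (q - 2) (q - 1))) := by
            rw [φ_a_of_lt (by omega) (by omega) (by omega),
              show q - 2 + 1 = q - 1 by omega, show q - 1 + 1 = q by omega,
              φ_a_last (by omega) (by omega), show q - 1 + 1 = q by omega]
          have h2 := key 2 (w * a q (q - 2) (q - 1))
            (mul_mem hw (a_mem_BKL (by omega) (by omega) (by omega)))
            (by rw [len_mul, len_a (by omega) (by omega) (by omega)]; rw [len_φ] at hl; exact hl)
            ⟨q - 2, q - 1, by omega, by omega, by omega, RightDvd.mul_left hw _⟩
          rw [hp1, h1, ← map_mul, ← map_mul]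
          exact h2
        · have h1 : a q p q = φ q (a q (p - 1) (q - 1)) := by
            rw [φ_a_of_lt (by omega) (by omega) (by omega), show p - 1 + 1 = p by omega,
              show q - 1 + 1 = q by omega]
          have h2 := key 1 (z * a q (p - 1) (q - 1))
            (mul_mem hz' (a_mem_BKL (by omega) (by omega) (by omega)))
            (by rw [len_mul, len_a (by omega) (by omega) (by omega)]; exact hl)
            ⟨p - 1, q - 1, by omega, by omega, by omega, RightDvd.mul_left hz' _⟩
          rw [h1, ← map_mul]
          exact h2
      · exact key 0 _ hx hl ⟨p, q, hp, hpq, hq, RightDvd.mul_left hz _⟩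

theorem len_pow (n : ℕ) (x : B n) (k : ℕ) : len n (x ^ k) = k * len n x := by
  induction k with
  | zero => simp [len_one]
  | succ k ih => rw [pow_succ, len_mul, ih]; push_cast; ring

theorem exists_pow_eq {x : B 2} (hx : x ∈ BKL 2) : ∃ i : ℕ, x = a 2 1 2 ^ i := by
  induction hx using Submonoid.closure_induction with
  | mem x hx =>
    obtain ⟨p, q, hp, hpq, hq, rfl⟩ := hx
    obtain rfl : p = 1 := by omega
    obtain rfl : q = 2 := by omega
    exact ⟨1, (pow_one _).symm⟩
  | one => exact ⟨0, rfl⟩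
  | mul x y _ _ hx hy =>
    obtain ⟨i, rfl⟩ := hx
    obtain ⟨j, rfl⟩ := hy
    exact ⟨i + j, (pow_add _ _ _).symm⟩

theorem rotLT_asymm (m : ℕ) : ∀ x y, RotLT (m + 2) x y → ¬ RotLT (m + 2) y x := by
  induction m with
  | zero =>
    rintro x y ⟨i, j, hij, rfl, rfl⟩ ⟨k, l, hkl, h1, h2⟩
    have e := len_a (n := 2) le_rfl one_lt_two le_rfl
    have h3 := congrArg (len 2) h1
    have h4 := congrArg (len 2) h2
    rw [len_pow, len_pow, e] at h3 h4
    omega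
  | succ m ih =>
    rintro x y ⟨s, t, hs, ht, h⟩ ⟨t', s', ht', hs', h'⟩
    obtain rfl := hs.unique hs'
    obtain rfl := ht.unique ht'
    have : Std.Asymm (RotLT (m + 2)) := ⟨ih⟩
    exact asymm_of (List.Shortlex (RotLT (m + 2))) h h'

theorem IsSplitting.exists_rotLT {m : ℕ}
    (hm : ∀ x ∈ BKL (m + 2), ∃ y ∈ BKL (m + 2), RotLT (m + 2) x y)
    {x : B (m + 3)} {s : List (B (m + 2))} (hs : IsSplitting (m + 3) x s) :
    ∃ (y : B (m + 3)) (s' : List (B (m + 2))),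
      IsSplitting (m + 3) y s' ∧ s'.length = s.length ∧ RotLT (m + 3) x y := by
  rcases List.eq_nil_or_concat s with rfl | ⟨s, t, rfl⟩
  · exact absurd rfl hs.2.1
  rw [List.concat_eq_append] at hs ⊢
  obtain ⟨t', ht', hlt⟩ := hm t (hs.2.2.1 t (by simp))
  have h1 : List.Shortlex (RotLT (m + 2)) (s ++ [t]) (s ++ [t']) :=
    List.Shortlex.append_left
      (List.Shortlex.of_lex (s := [t]) (t := [t']) rfl (List.Lex.rel hlt)) s
  have h2 : IsSplitting (m + 3) (splitProd (m + 3) (s ++ [t'])) (s ++ [t']) := by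
    by_cases hs0 : s = []
    · rw [hs0, List.nil_append, isSplitting_singleton]
      exact ⟨ht', splitProd_singleton _ _⟩
    · have h3 := (isSplitting_concat hs0).1 hs
      exact (isSplitting_concat hs0).2 ⟨h3.1, h3.2.1, ht', splitProd_concat _ _ _, h3.2.2.2.2⟩
  exact ⟨_, _, h2, by simp, _, _, hs, h2, h1⟩

theorem exists_rotLT (m : ℕ) : ∀ x ∈ BKL (m + 2), ∃ y ∈ BKL (m + 2), RotLT (m + 2) x y := by
  induction m with
  | zero =>
    intro x hx
    obtain ⟨i, rfl⟩ := exists_pow_eq hx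
    exact ⟨a 2 1 2 ^ (i + 1), pow_mem (a_mem_BKL le_rfl one_lt_two le_rfl) _,
      i, i + 1, Nat.lt_succ_self i, rfl, rfl⟩
  | succ m ih =>
    intro x hx
    obtain ⟨s, hs⟩ : ∃ s : List (B (m + 2)), IsSplitting (m + 3) x s :=
      exists_isSplitting (by omega) hx
    obtain ⟨y, s', hs', -, h⟩ := IsSplitting.exists_rotLT ih hs
    exact ⟨y, hs'.1, h⟩

theorem eq_or_lex_of_forall₂ {k : ℕ} {s t : List (B k)} (h : List.Forall₂ (RotLE k) s t) :
    s = t ∨ List.Lex (RotLT k) s t := by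
  induction h with
  | nil => exact Or.inl rfl
  | cons h _ ih =>
    rcases h with h | rfl
    · exact Or.inr (List.Lex.rel h)
    · rcases ih with rfl | ih
      · exact Or.inl rfl
      · exact Or.inr (List.Lex.cons ih)

theorem IsSplitting.rotLT_of_length_lt {m : ℕ} {x y : B (m + 3)} {s t : List (B (m + 2))}
    (hs : IsSplitting (m + 3) x s) (ht : IsSplitting (m + 3) y t) (h : s.length < t.length) :
    RotLT (m + 3) x y :=
  ⟨s, t, hs, ht, List.Shortlex.of_length_lt h⟩

theorem IsSplitting.rotLE_of_forall₂ {m : ℕ} {x y : B (m + 3)} {s t : List (B (m + 2))}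
    (hs : IsSplitting (m + 3) x s) (ht : IsSplitting (m + 3) y t)
    (h : List.Forall₂ (RotLE (m + 2)) s t) : RotLE (m + 3) x y := by
  rcases eq_or_lex_of_forall₂ h with rfl | h'
  · exact Or.inr (hs.2.2.2.2.1.trans ht.2.2.2.2.1.symm)
  · exact Or.inl ⟨s, t, hs, ht, List.Shortlex.of_lex h.length_eq h'⟩

theorem one_rotLE (m : ℕ) : ∀ x ∈ BKL (m + 2), RotLE (m + 2) 1 x := by
  induction m with
  | zero =>
    intro x hx
    obtain ⟨i, rfl⟩ := exists_pow_eq hx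
    rcases Nat.eq_zero_or_pos i with rfl | hi
    · exact Or.inr (pow_zero _).symm
    · exact Or.inl ⟨0, i, hi, (pow_zero _).symm, rfl⟩
  | succ m ih =>
    intro x hx
    obtain ⟨s, hs⟩ := exists_isSplitting (n := m + 3) (by omega) hx
    have h1 : IsSplitting (m + 3) 1 [1] := isSplitting_singleton.2 ⟨one_mem _, (map_one _).symm⟩
    rcases s with _ | ⟨b, _ | ⟨c, s⟩⟩
    · exact absurd rfl hs.2.1
    · exact h1.rotLE_of_forall₂ hs (.cons (ih b (hs.2.2.1 b (by simp))) .nil)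
    · exact Or.inl (h1.rotLT_of_length_lt hs (by simp))

theorem a_mul_φ_incl {n : ℕ} {b : B (n - 1)} (hb : b ∈ BKL (n - 1)) :
    ∃ w ∈ BKL n, a n 1 2 * φ n (incl n b) = w * a n 1 2 := by
  induction hb using Submonoid.closure_induction with
  | mem x hx =>
    obtain ⟨p, q, hp, hpq, hq, rfl⟩ := hx
    rw [incl_a hp hpq hq, φ_a_of_lt hp hpq (by omega)]
    rcases eq_or_lt_of_le hp with rfl | hp'
    · exact ⟨a n 1 (q + 1), a_mem_BKL le_rfl (by omega) (by omega),
        (a_triangle le_rfl one_lt_two (by omega) (by omega)).symm⟩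
    · exact ⟨a n (p + 1) (q + 1), a_mem_BKL (by omega) (by omega) (by omega),
        (a_commute_of_lt le_rfl one_lt_two (by omega) (by omega) (by omega)).eq⟩
  | one => exact ⟨1, one_mem _, by simp⟩
  | mul x y _ _ hx hy =>
    obtain ⟨v, hv, h1⟩ := hx
    obtain ⟨w, hw, h2⟩ := hy
    exact ⟨v * w, mul_mem hv hw, by rw [map_mul, map_mul, ← mul_assoc, h1, mul_assoc, h2, mul_assoc]⟩

theorem IsSplitting.isTail_take {n : ℕ} {β : B n} {s₁ s₂ : List (B (n - 1))}
    (h : IsSplitting n β (s₁ ++ s₂)) (h₂ : s₂ ≠ []) : IsTail n (φ n (splitProd n s₁)) 1 := by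
  have h1 := h.2.2.2.2.2 s₂.length (List.length_pos_iff.2 h₂) (by simp)
  have h3 : (s₁ ++ s₂).take ((s₁ ++ s₂).length - s₂.length) = s₁ := by simp
  rwa [h3] at h1

theorem IsSplitting.exists_rightDvd {n : ℕ} {β : B n} {s₁ s₂ : List (B (n - 1))} {b : B (n - 1)}
    (h : IsSplitting n β (s₁ ++ b :: s₂)) (h₂ : s₂ ≠ []) (hb : b ≠ 1) :
    ∃ p, 1 ≤ p ∧ p < n - 1 ∧ RightDvd (n - 1) (a (n - 1) p (n - 1)) b := by
  have h' : IsSplitting n β ((s₁ ++ [b]) ++ s₂) := by simpa using h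
  have h1 := h'.isTail_take h₂
  have hmem : ∀ c ∈ s₁ ++ [b], c ∈ BKL (n - 1) := fun c hc =>
    h'.2.2.1 c (List.mem_append_left _ hc)
  have hm1 : splitProd n s₁ ∈ BKL n := splitProd_mem fun c hc => hmem c (by simp [hc])
  rcases BKL.exists_mul_a (hmem b (by simp)) with rfl | ⟨p, q, hp, hpq, hq, z, hz, rfl⟩
  · exact absurd rfl hb
  rcases eq_or_lt_of_le hq with rfl | hq'
  · exact ⟨p, hp, hpq, RightDvd.mul_left hz _⟩
  · exfalso
    refine (isTail_one_iff (φ_mem (splitProd_mem hmem))).1 h1 (p + 1) (q + 1) (by omega) (by omega)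
      (by omega) ?_
    rw [splitProd_concat, map_mul (incl n), incl_a hp hpq hq, ← mul_assoc, map_mul,
      φ_a_of_lt hp hpq (by omega)]
    exact RightDvd.mul_left (φ_mem (mul_mem (φ_mem hm1) (incl_mem hz))) _

theorem IsSplitting.ne_one {n : ℕ} (hn : 3 ≤ n) {β : B n} {s₁ s₂ : List (B (n - 1))}
    {b : B (n - 1)} (h : IsSplitting n β (s₁ ++ b :: s₂)) (h₂ : 2 ≤ s₂.length) : b ≠ 1 := by
  induction s₁ using List.reverseRecOn generalizing b s₂ with
  | nil =>
    rintro rfl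
    exact h.2.2.2.1 (by simp; omega) rfl
  | append_singleton s c ih =>
    rintro rfl
    have h0 : IsSplitting n β (s ++ c :: 1 :: s₂) := by simpa using h
    have hc := ih h0 (by simp; omega)
    obtain ⟨p, hp, hpn, z, hz, rfl⟩ := h0.exists_rightDvd (by simp) hc
    obtain ⟨b, s₃, rfl⟩ : ∃ b s₃, s₂ = b :: s₃ := by
      cases s₂ with
      | nil => simp at h₂
      | cons b s₃ => exact ⟨b, s₃, rfl⟩
    set t := z * a (n - 1) p (n - 1)
    have hmem : ∀ c ∈ s ++ t :: 1 :: b :: s₃, c ∈ BKL (n - 1) := h0.2.2.1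
    have hb : b ∈ BKL (n - 1) := hmem b (by simp)
    have h1 : IsSplitting n β ((s ++ [t] ++ [1]) ++ b :: s₃) := by simpa using h0
    have h2 : IsSplitting n β ((s ++ [t] ++ [1] ++ [b]) ++ s₃) := by simpa using h0
    have h3 := h1.isTail_take (by simp)
    have h4 := h2.isTail_take (by rintro rfl; simp at h₂)
    obtain ⟨w, hw, h5⟩ : ∃ w ∈ BKL n, φ n (splitProd n (s ++ [t] ++ [1])) = w * a n 1 (p + 2) := by
      refine ⟨φ n (φ n (φ n (splitProd n s) * incl n z)), φ_mem (φ_mem (mul_mem (φ_mem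
        (splitProd_mem fun c hc => hmem c (by simp [hc]))) (incl_mem hz))), ?_⟩
      rw [splitProd_concat, splitProd_concat, map_one, mul_one, map_mul (incl n),
        incl_a hp hpn le_rfl, ← mul_assoc, map_mul, φ_a_of_lt hp hpn (by omega),
        show n - 1 + 1 = n by omega, map_mul, φ_a_last (by omega) (by omega)]
    have h6 : φ n (splitProd n (s ++ [t] ++ [1])) ∈ BKL n := by
      rw [h5]; exact mul_mem hw (a_mem_BKL le_rfl (by omega) (by omega))
    by_cases hpn' : p + 2 < n
    · refine (isTail_one_iff h6).1 h3 1 (p + 2) le_rfl (by omega) hpn' ?_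
      rw [h5]
      exact RightDvd.mul_left hw _
    · rw [splitProd_concat _ _ b] at h4
      refine (isTail_one_iff (φ_mem (mul_mem h6 (incl_mem hb)))).1 h4 1 2 le_rfl one_lt_two
        (by omega) ?_
      obtain ⟨v, hv, h7⟩ := a_mul_φ_incl hb
      rw [h5, show p + 2 = n by omega, map_mul, map_mul, φ_a_last le_rfl (by omega), mul_assoc, h7,
        ← mul_assoc]
      exact RightDvd.mul_left (mul_mem (φ_mem hw) hv) _

end DualBraid

namespace DualBraid

open Equiv Complemented

theorem Rel.mem_of_swap {p q r s : ℕ} (h : Rel (swap r s) p q) (hpq : p ≠ q) :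
    (p = r ∨ p = s) ∧ (q = r ∨ q = s) := by
  have h1 := h p
  have h2 := h q
  rw [swap_apply_def] at h1 h2
  unfold Gap at h1 h2
  grind

theorem NC.le_swapNC {x : NC} {p q : ℕ} (hp : 1 ≤ p) (hq : 1 ≤ q) (h : x ≤ swapNC p q) :
    x = 1 ∨ x = swapNC p q := by
  rw [NC.le_def, swapNC_val hp hq] at h
  have h1 : ∀ i, x.1 i ≠ i → (i = p ∨ i = q) ∧ (x.1 i = p ∨ x.1 i = q) := fun i hi =>
    (h i).mem_of_swap (Ne.symm hi)
  by_cases h2 : x.1 p = p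
  · left
    apply Subtype.ext
    ext i
    by_contra hi
    change ¬ x.1 i = i at hi
    have h3 := h1 i hi
    have h4 := x.1.injective.ne hi
    have h5 := h1 _ h4
    grind
  · right
    apply Subtype.ext
    ext i
    rw [swapNC_val hp hq, swap_apply_def]
    have h3 := h1 p h2
    have h4 := x.1.injective.ne h2
    have h5 := h1 _ h4
    have h6 := h1 i
    grind

/-- The orbit of the transposition `(n - 2, n - 1)` under rotation. -/
noncomputable def orb (n : ℕ) : ℕ → NC
  | 0 => swapNC (n - 2) (n - 1)
  | j + 1 => rot n (orb n j)

theorem exists_orb_eq {n : ℕ} (hn : 3 ≤ n) (j : ℕ) :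
    ∃ p q, (1 ≤ p ∧ p ≤ n) ∧ (1 ≤ q ∧ q ≤ n) ∧ orb n j = swapNC p q := by
  induction j with
  | zero => exact ⟨n - 2, n - 1, by omega, by omega, rfl⟩
  | succ j ih =>
    obtain ⟨p, q, hp, hq, h⟩ := ih
    exact ⟨_, _, (cyc_supp n).apply_mem hp, (cyc_supp n).apply_mem hq, by
      rw [orb, h, rot_swapNC hp hq]⟩

theorem orb_supp {n : ℕ} (hn : 3 ≤ n) (j : ℕ) : Supp n (orb n j).1 := by
  obtain ⟨p, q, hp, hq, h⟩ := exists_orb_eq hn j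
  rw [h]; exact supp_swapNC hp.1 hq.1 hp.2 hq.2

theorem orb_one {n : ℕ} (hn : 3 ≤ n) : orb n 1 = swapNC (n - 1) n := by
  rw [orb, orb, rot_swapNC ⟨by omega, by omega⟩ ⟨by omega, by omega⟩, cyc_apply, cyc_apply,
    if_pos (by omega), if_pos (by omega), show n - 2 + 1 = n - 1 by omega,
    show n - 1 + 1 = n by omega]

theorem orb_two {n : ℕ} (hn : 3 ≤ n) : orb n 2 = swapNC 1 n := by
  have h : rot n (orb n 1) = swapNC 1 n := by
    rw [orb_one hn, rot_swapNC ⟨by omega, by omega⟩ ⟨by omega, by omega⟩, cyc_apply, cyc_apply,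
      if_pos (by omega), if_neg (by omega), if_pos (by omega), show n - 1 + 1 = n by omega,
      swapNC_comm]
  exact h

theorem not_below_orb_mul_orb {n : ℕ} (hn : 3 ≤ n) (j : ℕ) :
    ¬ Below ((orb n (j + 1)).1 * (orb n j).1) ((orb n (j + 1)).1 * (orb n j).1) := by
  induction j with
  | zero =>
    intro h
    have h1 := h (n - 1) (n - 2)
    rw [orb_one hn, orb, swapNC_val (by omega) (by omega), swapNC_val (by omega) (by omega),
      Perm.mul_apply, Perm.mul_apply, swap_apply_left, swap_apply_left, swap_apply_right,
      swap_apply_of_ne_of_ne (by omega) (by omega)] at h1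
    unfold Gap at h1; omega
  | succ j ih =>
    intro h
    apply ih
    have hs := (orb_supp hn (j + 1)).mul (orb_supp hn j)
    have hc : (orb n (j + 1 + 1)).1 * (orb n (j + 1)).1 =
        cyc n * ((orb n (j + 1)).1 * (orb n j).1) * (cyc n)⁻¹ := by
      rw [orb, rot_val (orb_supp hn (j + 1))]
      conv_lhs => rw [orb, rot_val (orb_supp hn j)]
      rw [orb, rot_val (orb_supp hn j)]
      group
    have hs' : Supp n ((orb n (j + 1 + 1)).1 * (orb n (j + 1)).1) :=
      (orb_supp hn _).mul (orb_supp hn _)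
    obtain ⟨r, hr, hr', -⟩ := exists_rot_eq (t := ⟨_, h, n, hs'⟩) hs'
    have h2 := congrArg Subtype.val hr'
    rw [rot_val hr] at h2
    change _ = (orb n (j + 1 + 1)).1 * (orb n (j + 1)).1 at h2
    rw [hc] at h2
    rw [← mul_left_cancel (mul_right_cancel h2)]
    exact r.2.1

/-- The word of the braid `φ^{j + k - 1}(x) ⋯ φ^j(x)`, where `x = a_{n-2,n-1}`. -/
noncomputable def chain (n j k : ℕ) : List NC := (List.range k).map fun i => orb n (j + i)

theorem chain_w {n : ℕ} (hn : 3 ≤ n) (j k : ℕ) : W n (chain n j k) := by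
  intro s hs
  obtain ⟨i, -, rfl⟩ := List.mem_map.1 hs
  exact orb_supp hn _

theorem chain_succ (n j k : ℕ) : chain n j (k + 1) = chain n j k ++ [orb n (j + k)] := by
  rw [chain, List.range_succ, List.map_append]; rfl

theorem chain_succ' (n j k : ℕ) : chain n j (k + 1) = orb n j :: chain n (j + 1) k := by
  rw [chain, List.range_succ_eq_map, List.map_cons, List.map_map]
  congr 1
  refine List.map_congr_left fun i _ => ?_
  change orb n (j + (i + 1)) = _
  congr 1; omega

theorem map_rot_chain (n j k : ℕ) : (chain n j k).map (rot n) = chain n (j + 1) k := by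
  rw [chain, List.map_map]
  refine List.map_congr_left fun i _ => ?_
  change orb n (j + i + 1) = _
  congr 1; omega

theorem not_wdvd_chain {n : ℕ} (hn : 3 ≤ n) (k : ℕ) : ∀ (j : ℕ) (s : NC), ¬ s ≤ orb n j →
    ¬ WDvd [s] (chain n j k) := by
  induction k with
  | zero =>
    intro j s hs h
    have h1 : s = 1 := h s (List.mem_singleton_self s)
    rw [h1] at hs
    exact hs (NC.one_le _)
  | succ k ih =>
    intro j s hs h
    rw [chain_succ'] at h
    refine ih (j + 1) (res (orb n j) s) (fun hle => ?_) h
    obtain ⟨p, q, hp, hq, he⟩ := exists_orb_eq hn (j + 1)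
    rw [he] at hle
    rcases NC.le_swapNC hp.1 hq.1 hle with h1 | h1
    · exact hs (NC.res_eq_one.1 h1)
    · rw [← he] at h1
      apply not_below_orb_mul_orb hn j
      rw [← h1, NC.res_val, inv_mul_cancel_right]
      exact (orb n j ⊔ s).2.1

theorem isTail_ev_chain {n : ℕ} (hn : 3 ≤ n) {j : ℕ} (hj : j = 1 ∨ j = 2) (k : ℕ) :
    IsTail n (ev n (chain n j k)) 1 := by
  rw [isTail_one_iff (ev_mem_BKL (chain_w hn j k))]
  intro p q hp hpq hq hd
  rw [rightDvd_a_ev_iff hp hpq hq.le (chain_w hn j k)] at hd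
  refine not_wdvd_chain hn k j _ (fun hle => ?_) hd
  rw [swapNC_le hp (by omega)] at hle
  rcases hj with rfl | rfl
  · rw [orb_one hn, swapNC_val (by omega) (by omega)] at hle
    have := hle.mem_of_swap hpq.ne
    omega
  · rw [orb_two hn, swapNC_val (by omega) (by omega)] at hle
    have := hle.mem_of_swap hpq.ne
    omega

theorem braid_orb {n : ℕ} (hn : 3 ≤ n) (j : ℕ) :
    braid n (orb n j) = (φ n ^ j) (a n (n - 2) (n - 1)) := by
  induction j with
  | zero => exact braid_swapNC (by omega) (by omega) (by omega)
  | succ j ih => rw [φ_pow_succ_apply, ← ih, φ_braid (orb_supp hn j)]; rfl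

theorem ev_chain_succ {n : ℕ} (hn : 3 ≤ n) (j k : ℕ) : ev n (chain n j (k + 1)) =
    (φ n ^ (j + k)) (a n (n - 2) (n - 1)) * ev n (chain n j k) := by
  rw [chain_succ, ev_append, ev, ev, one_mul, braid_orb hn]

theorem sep_eq_ev_chain {n : ℕ} (hn : 3 ≤ n) (p : ℕ) : sep n p = ev n (chain n 2 p) := by
  induction p with
  | zero => rfl
  | succ p ih =>
    rw [ev_chain_succ hn, ← ih, sep, List.range_succ, List.reverse_append, List.map_append,
      List.prod_append, sep, Nat.add_comm 2 p]
    simp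

theorem splitProd_replicate {n : ℕ} (hn : 3 ≤ n) (k : ℕ) :
    splitProd n (List.replicate k (a (n - 1) (n - 2) (n - 1))) = ev n (chain n 0 k) := by
  induction k with
  | zero => rfl
  | succ k ih =>
    rw [List.replicate_succ, splitProd, ih, ev_chain_succ hn, List.length_replicate, Nat.zero_add,
      incl_a (by omega) (by omega) le_rfl]

theorem φ_ev_chain {n : ℕ} (hn : 3 ≤ n) (j k : ℕ) :
    φ n (ev n (chain n j k)) = ev n (chain n (j + 1) k) := by
  rw [φ_ev (chain_w hn j k), map_rot_chain]

theorem a_ne_one {n p q : ℕ} (hp : 1 ≤ p) (hpq : p < q) (hq : q ≤ n) : a n p q ≠ 1 := by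
  intro h
  have := congrArg (len n) h
  rw [len_a hp hpq hq, len_one] at this
  exact one_ne_zero this

theorem isSplitting_replicate {n : ℕ} (hn : 3 ≤ n) (k : ℕ) :
    IsSplitting n (ev n (chain n 0 (k + 1)))
      (List.replicate (k + 1) (a (n - 1) (n - 2) (n - 1))) := by
  have hx : a (n - 1) (n - 2) (n - 1) ∈ BKL (n - 1) := a_mem_BKL (by omega) (by omega) le_rfl
  induction k with
  | zero =>
    rw [← splitProd_replicate hn]
    exact isSplitting_singleton.2 ⟨hx, splitProd_singleton _ _⟩
  | succ k ih =>
    rw [List.replicate_succ', isSplitting_concat (by simp), splitProd_replicate hn]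
    refine ⟨ih, ?_, hx, ?_, ?_⟩
    · rw [List.replicate_succ, List.head?_cons]
      exact fun h => a_ne_one (by omega) (by omega) le_rfl (Option.some.inj h)
    · rw [← splitProd_replicate hn, List.replicate_succ', splitProd_concat, splitProd_replicate hn]
    · rw [φ_ev_chain hn]
      exact isTail_ev_chain hn (Or.inl rfl) _

theorem isSplitting_replicate_one {n : ℕ} (hn : 3 ≤ n) (k : ℕ) :
    IsSplitting n (ev n (chain n 1 (k + 1)))
      (List.replicate (k + 1) (a (n - 1) (n - 2) (n - 1)) ++ [1]) := by
  rw [isSplitting_concat (by simp), splitProd_replicate hn, φ_ev_chain hn, map_one, mul_one]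
  refine ⟨isSplitting_replicate hn k, ?_, one_mem _, rfl, isTail_ev_chain hn (Or.inl rfl) _⟩
  rw [List.replicate_succ, List.head?_cons]
  exact fun h => a_ne_one (by omega) (by omega) le_rfl (Option.some.inj h)

theorem isSplitting_sep {n p : ℕ} (hn : 3 ≤ n) (hp : 1 ≤ p) :
    IsSplitting n (sep n p) (List.replicate p (a (n - 1) (n - 2) (n - 1)) ++ [1, 1]) := by
  obtain ⟨k, rfl⟩ : ∃ k, p = k + 1 := ⟨p - 1, by omega⟩
  have h1 := isSplitting_replicate_one hn k
  rw [sep_eq_ev_chain hn, show List.replicate (k + 1) (a (n - 1) (n - 2) (n - 1)) ++ [1, 1] =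
    (List.replicate (k + 1) (a (n - 1) (n - 2) (n - 1)) ++ [1]) ++ [1] by simp,
    isSplitting_concat (by simp), ← h1.2.2.2.2.1, φ_ev_chain hn, map_one, mul_one]
  refine ⟨h1, h1.2.2.2.1 (by simp), one_mem _, rfl, isTail_ev_chain hn (Or.inr rfl) _⟩

theorem Δ_eq_incl_mul {n : ℕ} (hn : 2 ≤ n) : Δ n = incl n (Δ (n - 1)) * a n (n - 1) n := by
  have h : List.Ico 1 n = List.Ico 1 (n - 1) ++ [n - 1] := by
    obtain ⟨m, rfl⟩ : ∃ m, n = m + 1 := ⟨n - 1, by omega⟩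
    rw [Nat.add_sub_cancel, List.Ico.succ_top (by omega)]
  rw [Δ, h, List.map_append, List.prod_append, Δ, map_list_prod, List.map_map, List.map_singleton,
    List.prod_singleton, show n - 1 + 1 = n by omega]
  congr 2
  refine List.map_congr_left fun i hi => ?_
  rw [List.Ico.mem] at hi
  exact (incl_a (by omega) (by omega) (by omega)).symm

theorem sep_eq_mul {n : ℕ} (hn : 3 ≤ n) (p : ℕ) :
    sep n p = Δ n ^ p * (incl n (Δ (n - 1)) ^ p)⁻¹ := by
  have hX : (φ n ^ 2) (a n (n - 2) (n - 1)) = Δ n * (incl n (Δ (n - 1)))⁻¹ := by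
    rw [φ_pow_succ_apply, pow_one, φ_a_of_lt (by omega) (by omega) (by omega),
      show n - 2 + 1 = n - 1 by omega, show n - 1 + 1 = n by omega, φ_apply,
      Δ_eq_incl_mul (by omega)]
    group
  induction p with
  | zero => simp [sep]
  | succ p ih =>
    have h1 : φ n ^ p = MulAut.conj (Δ n ^ p) := by rw [φ, map_pow]
    rw [sep_eq_ev_chain hn, ev_chain_succ hn, ← sep_eq_ev_chain hn, ih, Nat.add_comm 2 p, pow_add,
      MulAut.mul_apply, hX, h1, MulAut.conj_apply, pow_succ (Δ n), pow_succ' (incl n _)]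
    group

theorem a_last_rotLE (m : ℕ) : ∀ (p : ℕ) (x : B (m + 2)), x ∈ BKL (m + 2) → 1 ≤ p → p < m + 2 →
    RightDvd (m + 2) (a (m + 2) p (m + 2)) x → RotLE (m + 2) (a (m + 2) (m + 1) (m + 2)) x := by
  induction m with
  | zero =>
    rintro p x - hp hp' ⟨z, hz, rfl⟩
    obtain rfl : p = 1 := by omega
    obtain ⟨i, rfl⟩ := exists_pow_eq hz
    rcases Nat.eq_zero_or_pos i with rfl | hi
    · exact Or.inr (one_mul _).symm
    · exact Or.inl ⟨1, i + 1, by omega, (pow_one _).symm, (pow_succ _ _).symm⟩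
  | succ m ih =>
    intro p x hx hp hp' hd
    have hn : 3 ≤ m + 3 := by omega
    have h1 : IsSplitting (m + 3) (a (m + 3) (m + 2) (m + 3)) [a (m + 2) (m + 1) (m + 2), 1] := by
      have h2 := isSplitting_replicate_one hn 0
      rw [ev_chain_succ hn] at h2
      have h3 : (φ (m + 3) ^ (1 + 0)) (a (m + 3) (m + 3 - 2) (m + 3 - 1)) =
          a (m + 3) (m + 2) (m + 3) := by
        rw [Nat.add_zero, pow_one, φ_a_of_lt (by omega) (by omega) (by omega)]
        rfl
      rw [h3] at h2
      have h4 : ev (m + 3) (chain (m + 3) 1 0) = 1 := rfl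
      rw [h4, mul_one] at h2
      exact h2
    obtain ⟨s, hs⟩ : ∃ s : List (B (m + 2)), IsSplitting (m + 3) x s :=
      exists_isSplitting (by omega) hx
    rcases s with _ | ⟨b, _ | ⟨c, _ | ⟨d, s⟩⟩⟩
    · exact absurd rfl hs.2.1
    · obtain ⟨hb, rfl⟩ := isSplitting_singleton.1 hs
      exact absurd hd (not_rightDvd_incl (n := m + 3) hp hp' hb)
    · have hb1 : b ≠ 1 := by
        rintro rfl
        exact hs.2.2.2.1 (by simp) rfl
      obtain ⟨p', h2, h3, h4⟩ := IsSplitting.exists_rightDvd (s₁ := []) hs (by simp) hb1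
      exact h1.rotLE_of_forall₂ hs (.cons (ih p' b (hs.2.2.1 b (by simp)) h2 h3 h4)
        (.cons (one_rotLE m c (hs.2.2.1 c (by simp))) .nil))
    · exact Or.inl (h1.rotLT_of_length_lt hs (by simp))

theorem sep_rotLE {m p : ℕ} (hp : 1 ≤ p) {γ : B (m + 3)} (h : HasBreadth (m + 3) γ (p + 2)) :
    RotLE (m + 3) (sep (m + 3) p) γ := by
  have hn : 3 ≤ m + 3 := by omega
  obtain ⟨s, hs, hlen⟩ : ∃ s : List (B (m + 2)), IsSplitting (m + 3) γ s ∧ s.length = p + 2 := h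
  refine (isSplitting_sep hn hp).rotLE_of_forall₂ hs ?_
  have hmem : ∀ b ∈ s, b ∈ BKL (m + 2) := hs.2.2.1
  rw [List.forall₂_iff_get]
  refine ⟨by simp [hlen], fun i h1 h2 => ?_⟩
  have hb : s.get ⟨i, h2⟩ ∈ BKL (m + 2) := hmem _ (List.get_mem _ _)
  by_cases hi : i < p
  · have e : s = s.take i ++ s.get ⟨i, h2⟩ :: s.drop (i + 1) := by
      simp
    have hs' : IsSplitting (m + 3) γ (s.take i ++ s.get ⟨i, h2⟩ :: s.drop (i + 1)) := by
      rw [← e]; exact hs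
    have hne := IsSplitting.ne_one (n := m + 3) hn hs' (by rw [List.length_drop]; omega)
    obtain ⟨q, h3, h4, h5⟩ := IsSplitting.exists_rightDvd (n := m + 3) hs'
      (by rw [Ne, ← List.length_eq_zero_iff, List.length_drop]; omega) hne
    have h6 := a_last_rotLE m q _ hb h3 h4 h5
    have h7 : (List.replicate p (a (m + 3 - 1) (m + 3 - 2) (m + 3 - 1)) ++ [1, 1]).get ⟨i, h1⟩ =
        a (m + 2) (m + 1) (m + 2) := by
      simp [hi]
    rw [h7]
    exact h6
  · have h7 : (List.replicate p (a (m + 3 - 1) (m + 3 - 2) (m + 3 - 1)) ++ [1, 1]).get ⟨i, h1⟩ =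
        1 := by
      obtain ⟨j, rfl⟩ : ∃ j, i = p + j := ⟨i - p, by omega⟩
      have hj : j = 0 ∨ j = 1 := by omega
      rcases hj with rfl | rfl <;> simp
    rw [h7]
    exact one_rotLE m _ hb

end DualBraid

theorem mainTheorem6 (n p : ℕ) (hn : 3 ≤ n) (hp : 1 ≤ p) :
    -- the splitting of the separator is `(a_{n-2,n-1}, …, a_{n-2,n-1}, 1, 1)`, of length `p + 2`
    (∀ s : List (DualBraid.B (n - 1)), DualBraid.IsSplitting n (DualBraid.sep n p) s ↔
      s = List.replicate p (DualBraid.a (n - 1) (n - 2) (n - 1)) ++ [1, 1]) ∧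
    -- the separator as a quotient of powers of Garside elements
    DualBraid.sep n p =
      DualBraid.Δ n ^ p * (DualBraid.incl n (DualBraid.Δ (n - 1)) ^ p)⁻¹ ∧
    -- the separator is the least braid with `n`-breadth `p + 2`
    (DualBraid.HasBreadth n (DualBraid.sep n p) (p + 2) ∧
      ∀ γ : DualBraid.B n, DualBraid.HasBreadth n γ (p + 2) →
        DualBraid.RotLE n (DualBraid.sep n p) γ) ∧
    -- the separator is the least upper bound of the braids with `n`-breadth at most `p + 1`
    ((∀ γ : DualBraid.B n, (∃ r ≤ p + 1, DualBraid.HasBreadth n γ r) →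
        DualBraid.RotLE n γ (DualBraid.sep n p)) ∧
      ∀ η ∈ DualBraid.BKL n,
        (∀ γ : DualBraid.B n, (∃ r ≤ p + 1, DualBraid.HasBreadth n γ r) →
          DualBraid.RotLE n γ η) →
        DualBraid.RotLE n (DualBraid.sep n p) η) := by
  obtain ⟨m, rfl⟩ : ∃ m, n = m + 3 := ⟨n - 3, by omega⟩
  have hsep := DualBraid.isSplitting_sep hn hp
  refine ⟨fun s => ⟨fun h => h.unique hsep, fun h => h ▸ hsep⟩, DualBraid.sep_eq_mul hn p,
    ⟨⟨_, hsep, by simp⟩, fun γ => DualBraid.sep_rotLE hp⟩, ?_, fun η hη hub => ?_⟩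
  · rintro γ ⟨r, hr, s, hs, rfl⟩
    exact Or.inl (DualBraid.IsSplitting.rotLT_of_length_lt hs hsep
      (by rw [List.length_append, List.length_replicate]; exact Nat.lt_succ_of_le hr))
  · obtain ⟨s, hs⟩ : ∃ s : List (DualBraid.B (m + 2)), DualBraid.IsSplitting (m + 3) η s :=
      DualBraid.exists_isSplitting hn hη
    rcases lt_trichotomy s.length (p + 2) with h | h | h
    · exfalso
      obtain ⟨γ, s', hs', hlen, hlt⟩ :=
        DualBraid.IsSplitting.exists_rotLT (DualBraid.exists_rotLT m) hs
      rcases hub γ ⟨_, by omega, s', hs', hlen⟩ with h1 | rfl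
      · exact DualBraid.rotLT_asymm (m + 1) _ _ hlt h1
      · exact DualBraid.rotLT_asymm (m + 1) _ _ hlt hlt
    · exact DualBraid.sep_rotLE hp ⟨s, hs, h⟩
    · exact Or.inl (DualBraid.IsSplitting.rotLT_of_length_lt hsep hs
        (by rw [List.length_append, List.length_replicate]; exact h))
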